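/- Let $\mathbb{T}_{2\pi}=\mathbb{R}/2\pi\mathbb{Z}$ and let $\langle f,g\rangle=\int_{\mathbb{T}_{2\pi}} f\,\overline{g}\,dy$ be the inner product of $L^2(\mathbb{T}_{2\pi};\mathbb{C})$. For $\nu>0$, $\delta\ge 1$ and $k=(k_1,k_2)\in\mathbb{Z}^2\setminus\{0\}$ put $|k|=\sqrt{k_1^2+k_2^2}$, $m_0=\delta^{-1}$, $\alpha^2=|k|^2\delta^2$, let $\alpha_k$ be the angle with $\cos\alpha_k=k_1/|k|$, $\sin\alpha_k=k_2/|k|$, and let $$\mathcal{L}_{k_1,k_2}=-\nu m_0^2\,\partial_y^2+i|k|\delta^2\sin(y+\alpha_k)\bigl(1-(\alpha^2-\partial_y^2)^{-1}\bigr),\qquad D(\mathcal{L}_{k_1,k_2})=H^2(\mathbb{T}_{2\pi}).$$ For $\alpha^2>1$ let $\langle u,w\rangle_*=\langle u,\,w-(\alpha^2-\partial_y^2)^{-1}w\rangle$ and $\|u\|_*=\langle u,u\rangle_*^{1/2}$, and define the pseudospectral bound $$\Psi(\mathcal{L}_{k_1,k_2})=\inf\bigl\{\|(\mathcal{L}_{k_1,k_2}-i\lambda)u\|_*:\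 u\in H^2(\mathbb{T}_{2\pi}),\ \lambda\in\mathbb{R},\ \|u\|_*=1\bigr\}.$$ Lemma 3.2. There exist constants $c_2>0$ and $\nu_0>0$, independent of $\nu$, $k$ and $\delta$, such that for every $\delta\ge1$, every $0<\nu<\nu_0$ and every $k\in\mathbb{Z}^2$ with $\alpha^2=|k|^2\delta^2>1$, $$\Psi(\mathcal{L}_{k_1,k_2})\ \ge\ c_2\,|k|^{1/2}\nu^{1/2}\bigl(1-\alpha^{-2}\bigr)^{3/2}.$$ -/

import Mathlib

open MeasureTheory
open scoped ContDiff

namespace HelicalFlow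

noncomputable section

instance instFactTwoPiPos : Fact (0 < 2 * Real.pi) := ⟨Real.two_pi_pos⟩

/-- The circle `𝕋_{2π} = ℝ / 2πℤ`. -/
abbrev Circle2Pi : Type := AddCircle (2 * Real.pi)

/-- `L²(𝕋_{2π}; ℂ)`. The measure is `dy / (2π)`; the constant factor `2π` relating it to `dy`
is irrelevant for the pseudospectral bound, in which norms occur only as quotients. -/
abbrev L2Circle : Type := Lp ℂ 2 (@AddCircle.haarAddCircle (2 * Real.pi) instFactTwoPiPos)

/-- `v` is the weak derivative of `u` on the circle: `∫ u φ' dy = - ∫ v φ dy` for every smooth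
`2π`-periodic test function `φ`. -/
def IsWeakDeriv (u v : L2Circle) : Prop :=
  ∀ φ : ℝ → ℂ, ContDiff ℝ ∞ φ → Function.Periodic φ (2 * Real.pi) →
    ∫ y in (0 : ℝ)..(2 * Real.pi), u (y : Circle2Pi) * deriv φ y =
      - ∫ y in (0 : ℝ)..(2 * Real.pi), v (y : Circle2Pi) * φ y

/-- `g` is the second weak derivative of `u`, and the first one is in `L²` as well. -/
def IsWeakDeriv2 (u g : L2Circle) : Prop :=
  ∃ v : L2Circle, IsWeakDeriv u v ∧ IsWeakDeriv v g

theorem integral_circle (f : Circle2Pi → ℂ) :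
    ∫ y in (0 : ℝ)..(2 * Real.pi), f (y : Circle2Pi) =
      (2 * Real.pi : ℝ) • ∫ t, f t ∂(AddCircle.haarAddCircle (T := 2 * Real.pi)) := by
  have h := AddCircle.intervalIntegral_preimage (2 * Real.pi) 0 f
  rw [zero_add] at h
  rw [h, AddCircle.integral_haarAddCircle, smul_inv_smul₀ Real.two_pi_pos.ne']

/-- The integral of an `L²` function against a continuous periodic function, as an inner product. -/
theorem integral_mul_eq_inner (ψ : ℝ → ℂ) (hψ : Continuous ψ)
    (hp : Function.Periodic ψ (2 * Real.pi)) :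
    ∃ p : L2Circle, ∀ u : L2Circle,
      ∫ y in (0 : ℝ)..(2 * Real.pi), u (y : Circle2Pi) * ψ y =
        (2 * Real.pi : ℝ) • inner ℂ p u := by
  have hc : Continuous (hp.lift : Circle2Pi → ℂ) := hψ.quotient_liftOn' _
  let q : C(Circle2Pi, ℂ) := ⟨fun t => (starRingEnd ℂ) (hp.lift t), Complex.continuous_conj.comp hc⟩
  refine ⟨ContinuousMap.toLp (E := ℂ) 2 AddCircle.haarAddCircle ℂ q, fun u => ?_⟩
  have h1 := integral_circle (fun t => u t * hp.lift t)
  simp only [Function.Periodic.lift_coe] at h1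
  rw [h1, L2.inner_def]
  congr 1
  apply integral_congr_ae
  filter_upwards [ContinuousMap.coeFn_toLp (p := 2) (𝕜 := ℂ) AddCircle.haarAddCircle q] with t ht
  rw [ht]
  simp [q]

theorem fourier_eq_exp (n : ℤ) (y : ℝ) :
    fourier n (y : Circle2Pi) = Complex.exp (Complex.I * n * y) := by
  rw [fourier_coe_apply]
  congr 1
  have : (Real.pi : ℂ) ≠ 0 := by exact_mod_cast Real.pi_ne_zero
  push_cast
  field_simp

theorem hasDerivAt_mode (n : ℤ) (y : ℝ) :
    HasDerivAt (fun y : ℝ => fourier n (y : Circle2Pi))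
      (Complex.I * n * fourier n (y : Circle2Pi)) y := by
  convert hasDerivAt_fourier (2 * Real.pi) n y using 2
  have : (Real.pi : ℂ) ≠ 0 := by exact_mod_cast Real.pi_ne_zero
  push_cast
  field_simp

theorem mode_periodic (n : ℤ) :
    Function.Periodic (fun y : ℝ => fourier n (y : Circle2Pi)) (2 * Real.pi) := by
  intro y
  simp only [AddCircle.coe_add_period]

theorem contDiff_mode (n : ℤ) : ContDiff ℝ ∞ (fun y : ℝ => fourier n (y : Circle2Pi)) := by
  have : (fun y : ℝ => fourier n (y : Circle2Pi)) =
      fun y : ℝ => Complex.exp (Complex.I * n * y) := funext (fourier_eq_exp n)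
  rw [this]
  have h : ContDiff ℝ ∞ (fun y : ℝ => (y : ℂ)) := Complex.ofRealCLM.contDiff
  exact (contDiff_const.mul h).cexp

theorem fourierCoeff_eq (u : L2Circle) (n : ℤ) :
    fourierCoeff u n = (1 / (2 * Real.pi)) •
      ∫ y in (0 : ℝ)..(2 * Real.pi), u (y : Circle2Pi) * fourier (-n) (y : Circle2Pi) := by
  rw [fourierCoeff_eq_intervalIntegral u n 0, zero_add]
  congr 1
  apply intervalIntegral.integral_congr
  intro y _
  simp only [smul_eq_mul, mul_comm]

/-- Weak differentiation on the circle in terms of Fourier coefficients. -/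
theorem isWeakDeriv_iff (u v : L2Circle) :
    IsWeakDeriv u v ↔ ∀ n : ℤ, fourierCoeff v n = Complex.I * n * fourierCoeff u n := by
  constructor
  · intro h n
    have h1 := h _ (contDiff_mode (-n)) (mode_periodic (-n))
    have h2 : deriv (fun y : ℝ => fourier (-n) (y : Circle2Pi)) =
        fun y : ℝ => Complex.I * ((-n : ℤ) : ℂ) * fourier (-n) (y : Circle2Pi) :=
      funext fun y => (hasDerivAt_mode (-n) y).deriv
    have h3 : ∀ y : ℝ, u (y : Circle2Pi) *
        (Complex.I * ((-n : ℤ) : ℂ) * fourier (-n) (y : Circle2Pi)) =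
        (Complex.I * ((-n : ℤ) : ℂ)) * (u (y : Circle2Pi) * fourier (-n) (y : Circle2Pi)) :=
      fun y => by ring
    rw [h2] at h1
    simp only [h3] at h1
    rw [intervalIntegral.integral_const_mul] at h1
    rw [fourierCoeff_eq v n, fourierCoeff_eq u n, mul_smul_comm]
    congr 1
    rw [← neg_eq_iff_eq_neg] at h1
    rw [← h1]
    push_cast
    ring
  · intro h φ hφ hp
    have hd : Continuous (deriv φ) := hφ.continuous_deriv (by simp)
    have hdp : Function.Periodic (deriv φ) (2 * Real.pi) := by
      intro y
      rw [← deriv_comp_add_const φ (2 * Real.pi) y]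
      congr 1
      exact funext hp
    obtain ⟨p, hpp⟩ := integral_mul_eq_inner φ hφ.continuous hp
    obtain ⟨q, hqq⟩ := integral_mul_eq_inner (deriv φ) hd hdp
    rw [hpp, hqq, ← smul_neg]
    congr 1
    have key : ∀ n : ℤ, inner ℂ q (fourierLp 2 n : L2Circle) =
        - (Complex.I * n * inner ℂ p (fourierLp 2 n : L2Circle)) := by
      intro n
      have e : ∀ ψ : ℝ → ℂ, ∀ hψ : Function.Periodic ψ (2 * Real.pi),
          ∫ y in (0 : ℝ)..(2 * Real.pi), (fourierLp 2 n : L2Circle) (y : Circle2Pi) * ψ y =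
          ∫ y in (0 : ℝ)..(2 * Real.pi), fourier n (y : Circle2Pi) * ψ y := by
        intro ψ hψ
        have a1 := integral_circle (fun t => (fourierLp 2 n : L2Circle) t * hψ.lift t)
        have a2 := integral_circle (fun t => fourier n t * hψ.lift t)
        simp only [Function.Periodic.lift_coe] at a1 a2
        rw [a1, a2]
        congr 1
        apply integral_congr_ae
        filter_upwards [coeFn_fourierLp (T := 2 * Real.pi) 2 n] with t ht
        rw [ht]
      have e1 := hpp (fourierLp 2 n)
      have e2 := hqq (fourierLp 2 n)
      rw [e φ hp] at e1
      rw [e (deriv φ) hdp] at e2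
      have hφd : ∀ y, HasDerivAt φ (deriv φ y) y := fun y =>
        (hφ.differentiable (by simp) y).hasDerivAt
      have cm : Continuous (fun y : ℝ => fourier n (y : Circle2Pi)) := (contDiff_mode n).continuous
      have ibp := intervalIntegral.integral_mul_deriv_eq_deriv_mul
        (a := 0) (b := 2 * Real.pi) (u := fun y : ℝ => fourier n (y : Circle2Pi)) (v := φ)
        (u' := fun y : ℝ => Complex.I * n * fourier n (y : Circle2Pi)) (v' := deriv φ)
        (fun y _ => hasDerivAt_mode n y) (fun y _ => hφd y)
        ((continuous_const.mul cm).intervalIntegrable _ _) (hd.intervalIntegrable _ _)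
      have b1 : φ (2 * Real.pi) = φ 0 := by simpa using hp 0
      have b2 : fourier n ((2 * Real.pi : ℝ) : Circle2Pi) = fourier n ((0 : ℝ) : Circle2Pi) := by
        simpa using mode_periodic n 0
      simp only [mul_assoc, intervalIntegral.integral_const_mul] at ibp
      rw [b1, b2, sub_self, zero_sub, e1, e2] at ibp
      have hpi : (2 * Real.pi : ℝ) ≠ 0 := Real.two_pi_pos.ne'
      apply smul_right_injective ℂ hpi
      simp only
      rw [ibp, smul_neg, mul_assoc, mul_smul_comm, mul_smul_comm]
    have s1 := (hasSum_fourier_series_L2 u).mapL (innerSL ℂ q)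
    have s2 := ((hasSum_fourier_series_L2 v).mapL (innerSL ℂ p)).neg
    have s3 : ∀ n : ℤ, innerSL ℂ q (fourierCoeff u n • (fourierLp 2 n : L2Circle)) =
        - innerSL ℂ p (fourierCoeff v n • (fourierLp 2 n : L2Circle)) := by
      intro n
      rw [map_smul, map_smul, innerSL_apply_apply, innerSL_apply_apply, key n, h n, smul_eq_mul,
        smul_eq_mul]
      ring
    exact s1.unique (s2.congr_fun s3)

theorem ext_fourierCoeff {u v : L2Circle} (h : ∀ n : ℤ, fourierCoeff u n = fourierCoeff v n) :
    u = v := by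
  apply fourierBasis.repr.injective
  ext n
  rw [fourierBasis_repr, fourierBasis_repr, h n]

theorem coeff_add (u v : L2Circle) (n : ℤ) :
    fourierCoeff (u + v : L2Circle) n = fourierCoeff u n + fourierCoeff v n := by
  simp only [← fourierBasis_repr, map_add, lp.coeFn_add, Pi.add_apply]

theorem coeff_sub (u v : L2Circle) (n : ℤ) :
    fourierCoeff (u - v : L2Circle) n = fourierCoeff u n - fourierCoeff v n := by
  simp only [← fourierBasis_repr, map_sub, lp.coeFn_sub, Pi.sub_apply]

theorem coeff_smul (c : ℂ) (u : L2Circle) (n : ℤ) :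
    fourierCoeff (c • u : L2Circle) n = c * fourierCoeff u n := by
  simp only [← fourierBasis_repr, map_smul, lp.coeFn_smul, Pi.smul_apply, smul_eq_mul]

theorem coeff_zero (n : ℤ) : fourierCoeff (0 : L2Circle) n = 0 := by
  simp only [← fourierBasis_repr, map_zero, lp.coeFn_zero, Pi.zero_apply]

theorem IsWeakDeriv.add {u v u' v' : L2Circle} (h : IsWeakDeriv u u') (k : IsWeakDeriv v v') :
    IsWeakDeriv (u + v) (u' + v') := by
  rw [isWeakDeriv_iff] at *
  intro n
  rw [coeff_add, coeff_add, h, k]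
  ring

theorem IsWeakDeriv.smul {u u' : L2Circle} (c : ℂ) (h : IsWeakDeriv u u') :
    IsWeakDeriv (c • u) (c • u') := by
  rw [isWeakDeriv_iff] at *
  intro n
  rw [coeff_smul, coeff_smul, h]
  ring

theorem isWeakDeriv_zero : IsWeakDeriv 0 0 := by
  rw [isWeakDeriv_iff]
  intro n
  rw [coeff_zero, mul_zero]

theorem IsWeakDeriv2.coeff {u g : L2Circle} (h : IsWeakDeriv2 u g) (n : ℤ) :
    fourierCoeff g n = -(n : ℂ) ^ 2 * fourierCoeff u n := by
  obtain ⟨v, h1, h2⟩ := h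
  rw [isWeakDeriv_iff] at h1 h2
  rw [h2, h1]
  linear_combination (n : ℂ) ^ 2 * fourierCoeff u n * Complex.I_sq

theorem IsWeakDeriv2.unique {u g g' : L2Circle} (h : IsWeakDeriv2 u g) (h' : IsWeakDeriv2 u g') :
    g = g' :=
  ext_fourierCoeff fun n => by rw [h.coeff, h'.coeff]

/-- The Sobolev space `H²(𝕋_{2π})`: all `u ∈ L²` whose first and second weak derivatives are
in `L²`. -/
def H2 : Submodule ℂ L2Circle where
  carrier := {u | ∃ g, IsWeakDeriv2 u g}
  add_mem' := by
    rintro u v ⟨g, u', h1, h2⟩ ⟨g', v', k1, k2⟩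
    exact ⟨g + g', u' + v', h1.add k1, h2.add k2⟩
  zero_mem' := ⟨0, 0, isWeakDeriv_zero, isWeakDeriv_zero⟩
  smul_mem' := by
    rintro c u ⟨g, u', h1, h2⟩
    exact ⟨c • g, c • u', h1.smul c, h2.smul c⟩

/-- The second derivative `∂_y² : H²(𝕋_{2π}) → L²(𝕋_{2π})`. -/
def d2 : H2 →ₗ[ℂ] L2Circle where
  toFun u := Classical.choose u.2
  map_add' u v := by
    obtain ⟨u', h1, h2⟩ := Classical.choose_spec u.2
    obtain ⟨v', k1, k2⟩ := Classical.choose_spec v.2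
    exact (Classical.choose_spec (u + v).2).unique ⟨u' + v', h1.add k1, h2.add k2⟩
  map_smul' c u := by
    obtain ⟨u', h1, h2⟩ := Classical.choose_spec u.2
    exact (Classical.choose_spec (c • u).2).unique ⟨c • u', h1.smul c, h2.smul c⟩

theorem d2_spec (u : H2) : IsWeakDeriv2 u (d2 u) := Classical.choose_spec u.2

theorem exists_multiplier (c : ℤ → ℂ) (C : ℝ) (hc : ∀ n, ‖c n‖ ≤ C) (w : L2Circle) :
    ∃ u : L2Circle, ∀ n, fourierCoeff u n = c n * fourierCoeff w n := by
  have hm : Memℓp (fun n => c n * fourierBasis.repr w n) 2 := by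
    have h := (lp.memℓp (fourierBasis.repr w)).const_smul (C : ℂ)
    refine h.mono' (fun n => ?_)
    simp only [Pi.smul_apply, norm_smul, norm_mul, Complex.norm_real, Real.norm_eq_abs]
    gcongr
    exact (hc n).trans (le_abs_self C)
  refine ⟨fourierBasis.repr.symm ⟨_, hm⟩, fun n => ?_⟩
  rw [← fourierBasis_repr, ← fourierBasis_repr, LinearIsometryEquiv.apply_symm_apply]

/-- The operator `a - ∂_y² : H²(𝕋_{2π}) → L²(𝕋_{2π})`. -/
def helmholtz (a : ℝ) : H2 →ₗ[ℂ] L2Circle := (a : ℂ) • H2.subtype - d2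

theorem helmholtz_coeff (a : ℝ) (u : H2) (n : ℤ) :
    fourierCoeff (helmholtz a u) n = ((a + (n : ℝ) ^ 2 : ℝ) : ℂ) * fourierCoeff (u : L2Circle) n := by
  have : helmholtz a u = (a : ℂ) • (u : L2Circle) - d2 u := rfl
  rw [this, coeff_sub, coeff_smul, (d2_spec u).coeff]
  push_cast
  ring

theorem helmholtz_bijective {a : ℝ} (ha : 0 < a) : Function.Bijective (helmholtz a) := by
  have hpos : ∀ n : ℤ, 0 < a + (n : ℝ) ^ 2 := fun n => by positivity
  constructor
  · intro u v huv
    apply Subtype.ext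
    apply ext_fourierCoeff
    intro n
    have h := congrArg (fun z : L2Circle => fourierCoeff z n) huv
    simp only [helmholtz_coeff] at h
    exact mul_left_cancel₀ (by exact_mod_cast (hpos n).ne') h
  · intro w
    have hsq : ∀ n : ℤ, |(n : ℝ)| ≤ 1 + (n : ℝ) ^ 2 := fun n => by
      rw [abs_le]
      constructor <;> nlinarith [sq_nonneg ((n : ℝ) - 1), sq_nonneg ((n : ℝ) + 1)]
    have hb : ∀ n : ℤ, 1 / (a + (n : ℝ) ^ 2) ≤ 1 / a := fun n =>
      one_div_le_one_div_of_le ha (by nlinarith [sq_nonneg (n : ℝ)])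
    have hb2 : ∀ n : ℤ, (n : ℝ) ^ 2 * (1 / (a + (n : ℝ) ^ 2)) ≤ 1 := fun n => by
      rw [mul_one_div, div_le_one (hpos n)]
      linarith
    have hb0 : ∀ n : ℤ, 0 ≤ 1 / (a + (n : ℝ) ^ 2) := fun n => (one_div_pos.2 (hpos n)).le
    obtain ⟨ψ, hψ⟩ := exists_multiplier (fun n => ((1 / (a + (n : ℝ) ^ 2) : ℝ) : ℂ)) (1 / a)
      (fun n => by
        rw [Complex.norm_real, Real.norm_eq_abs, abs_of_nonneg (hb0 n)]
        exact hb n) w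
    obtain ⟨v, hv⟩ := exists_multiplier
      (fun n => Complex.I * (((n : ℝ) * (1 / (a + (n : ℝ) ^ 2)) : ℝ) : ℂ)) (1 / a + 1)
      (fun n => by
        rw [norm_mul, Complex.norm_I, one_mul, Complex.norm_real, Real.norm_eq_abs, abs_mul,
          abs_of_nonneg (hb0 n)]
        calc |(n : ℝ)| * (1 / (a + (n : ℝ) ^ 2)) ≤ (1 + (n : ℝ) ^ 2) * (1 / (a + (n : ℝ) ^ 2)) :=
              mul_le_mul_of_nonneg_right (hsq n) (hb0 n)
          _ ≤ 1 / a + 1 := by rw [add_mul, one_mul]; exact add_le_add (hb n) (hb2 n)) w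
    obtain ⟨g, hg⟩ := exists_multiplier
      (fun n => (((n : ℝ) ^ 2 * (1 / (a + (n : ℝ) ^ 2)) : ℝ) : ℂ)) 1
      (fun n => by
        rw [Complex.norm_real, Real.norm_eq_abs,
          abs_of_nonneg (mul_nonneg (sq_nonneg _) (hb0 n))]
        exact hb2 n) w
    have h2 : IsWeakDeriv2 ψ ((-1 : ℂ) • g) := by
      refine ⟨v, (isWeakDeriv_iff _ _).2 fun n => ?_, (isWeakDeriv_iff _ _).2 fun n => ?_⟩
      · rw [hv, hψ]
        push_cast
        ring
      · rw [coeff_smul, hv, hg]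
        push_cast
        linear_combination (-((n : ℂ) ^ 2 * (1 / ((a : ℂ) + (n : ℂ) ^ 2)) *
          fourierCoeff w n)) * Complex.I_sq
    refine ⟨⟨ψ, _, h2⟩, ext_fourierCoeff fun n => ?_⟩
    rw [helmholtz_coeff, hψ, ← mul_assoc, ← Complex.ofReal_mul, mul_one_div_cancel (hpos n).ne',
      Complex.ofReal_one, one_mul]

/-- `(a - ∂_y²)⁻¹` for `a > 0`, as a linear map of `L²(𝕋_{2π})` (the value for `a ≤ 0` is a
convention and is never used). -/
def helmholtzInv (a : ℝ) : L2Circle →ₗ[ℂ] L2Circle :=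
  open Classical in
  if ha : 0 < a then
    H2.subtype ∘ₗ (LinearEquiv.ofBijective (helmholtz a) (helmholtz_bijective ha)).symm.toLinearMap
  else 0

theorem sin_add_periodic (β : ℝ) :
    Function.Periodic (fun y : ℝ => Real.sin (y + β)) (2 * Real.pi) := by
  intro y
  simp only
  rw [add_right_comm, Real.sin_add_two_pi]

/-- The function `y ↦ sin (y + β)` on the circle. -/
def sinShift (β : ℝ) : Circle2Pi → ℝ := (sin_add_periodic β).lift

theorem memLp_sinShift_mul (β : ℝ) (u : L2Circle) :
    MemLp (fun t => (sinShift β t : ℂ) * u t) 2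
      (@AddCircle.haarAddCircle (2 * Real.pi) instFactTwoPiPos) := by
  have hc : Continuous (sinShift β) :=
    (Real.continuous_sin.comp (continuous_id.add continuous_const)).quotient_liftOn' _
  refine MemLp.of_le (Lp.memLp u)
    ((Complex.continuous_ofReal.comp hc).aestronglyMeasurable.mul (Lp.aestronglyMeasurable u))
    (Filter.Eventually.of_forall fun t => ?_)
  rw [norm_mul]
  refine mul_le_of_le_one_left (norm_nonneg _) ?_
  induction t using QuotientAddGroup.induction_on with
  | H y =>
    rw [Complex.norm_real]
    exact Real.abs_sin_le_one _

/-- Multiplication by `sin (y + β)` on `L²(𝕋_{2π})`. -/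
def mulSin (β : ℝ) : L2Circle →ₗ[ℂ] L2Circle where
  toFun u := (memLp_sinShift_mul β u).toLp
  map_add' u v := by
    rw [← MemLp.toLp_add]
    apply MemLp.toLp_congr
    filter_upwards [Lp.coeFn_add u v] with t ht
    rw [ht]
    simp only [Pi.add_apply, mul_add]
  map_smul' c u := by
    rw [RingHom.id_apply, ← MemLp.toLp_const_smul]
    apply MemLp.toLp_congr
    filter_upwards [Lp.coeFn_smul c u] with t ht
    rw [ht]
    simp only [Pi.smul_apply, smul_eq_mul]
    ring

/-- `|k| = (k₁² + k₂²)^{1/2}`. -/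
def kNorm (k₁ k₂ : ℤ) : ℝ := Real.sqrt ((k₁ : ℝ) ^ 2 + (k₂ : ℝ) ^ 2)

/-- The angle `α_k` with `cos α_k = k₁ / |k|` and `sin α_k = k₂ / |k|` (for `k ≠ 0`). -/
def kAngle (k₁ k₂ : ℤ) : ℝ := Complex.arg ((k₁ : ℂ) + (k₂ : ℂ) * Complex.I)

/-- `α² = |k|² δ²`. -/
def alphaSq (δ : ℝ) (k₁ k₂ : ℤ) : ℝ := kNorm k₁ k₂ ^ 2 * δ ^ 2

/-- The operator `ℒ_{k₁,k₂} = -ν m₀² ∂_y² + i |k| δ² sin (y + α_k) (1 - (α² - ∂_y²)⁻¹)`, where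
`m₀ = δ⁻¹`, as an unbounded operator in `L²(𝕋_{2π})` with domain `H²(𝕋_{2π})`. -/
def opL (ν δ : ℝ) (k₁ k₂ : ℤ) : L2Circle →ₗ.[ℂ] L2Circle where
  domain := H2
  toFun := (-((ν * (δ⁻¹) ^ 2 : ℝ) : ℂ)) • d2 +
    (Complex.I * ((kNorm k₁ k₂ * δ ^ 2 : ℝ) : ℂ)) •
      (mulSin (kAngle k₁ k₂) ∘ₗ (LinearMap.id - helmholtzInv (alphaSq δ k₁ k₂)) ∘ₗ H2.subtype)

/-- `⟨u, w⟩_* = ⟨u, w - (a - ∂_y²)⁻¹ w⟩` with `a = α²`, where `⟨f, g⟩` is the integral of `f` times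
the conjugate of `g` (Mathlib's `inner ℂ g f`). -/
def starInner (a : ℝ) (u w : L2Circle) : ℂ := inner ℂ (w - helmholtzInv a w) u

/-- `‖u‖_* = ⟨u, u⟩_*^{1/2}`. -/
def starNorm (a : ℝ) (u : L2Circle) : ℝ := Real.sqrt (starInner a u u).re

/-- The pseudospectral bound
`Ψ(H) = inf { N ((H - iμ) u) : u ∈ D(H), μ ∈ ℝ, N u = 1 }` of an unbounded operator `H`, with
respect to the norm `N`. -/
def pseudospectralBound (N : L2Circle → ℝ) (H : L2Circle →ₗ.[ℂ] L2Circle) : ℝ :=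
  sInf {r : ℝ | ∃ (u : H.domain) (μ : ℝ), N u = 1 ∧
    r = N (H u - (Complex.I * (μ : ℂ)) • (u : L2Circle))}

end

end HelicalFlow

namespace HelicalFlow

noncomputable section

open scoped ComplexConjugate

/-! ### Inner products and operators in terms of Fourier coefficients -/

/-! Write `H = (a - ∂²)⁻¹`, `S = 1 - H`, `w = S u`, `T = sin · S`, with `a = α²`. Dividing by
`|k|δ²` leaves `F = i (T - l) u - ε u''` with `ε = ν / (|k|δ⁴)`, and the claim becomes `‖F‖_* ≥ c
ε^{1/2} (1 - 1/a)^{3/2}` when `‖u‖_* = 1`. The rate `ε^{1/2}` comes from the critical points of the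
sine, where the phase is quadratic and the viscous layer has width `ε^{1/4}`.

The operator `T` is symmetric for the star inner product, so pairing with `w` gives plain energy
control of `u'`. The remaining information comes from a commutator. Pairing `(T - l) u` with the
antisymmetric part of `cos ∂` applied to `w` removes `l` and produces `z² = ‖cos w‖_*² + commForm`
(`IsResolventSol.commutator`). In Fourier variables `commForm` is diagonal and nonnegative
(`hasSum_commForm`). It controls `H w'`, and also the part of `cos w` that the star norm loses as `a
→ 1`. Hence `z` controls `‖cos w‖` and `⟨w, H w⟩`.

Now `1 = ‖u‖_*² = ‖w‖² + ⟨H u, w⟩`. The second term is at most `⟨w, H w⟩ / (1 - 1/a)`, and the first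
is bounded through `z` and `u'` by an uncertainty inequality (`IsWeakDeriv.norm_sq_le`). The
commutator bound involves `cos w'`, which is estimated by testing with `(1 - T²) u` (`cos_deriv`).
That estimate contains `|1 - l²|`, bounded by `one_sub_abs_le` and `abs_le`. The inequalities are
closed by elementary algebra in `forcing_lower_bound`. -/

theorem hasSum_inner_fourierCoeff (u v : L2Circle) :
    HasSum (fun n : ℤ => conj (fourierCoeff u n) * fourierCoeff v n) (inner ℂ u v) := by
  have h := lp.hasSum_inner (𝕜 := ℂ) (fourierBasis.repr u) (fourierBasis.repr v)
  rw [LinearIsometryEquiv.inner_map_map] at h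
  simp only [fourierBasis_repr] at h
  refine (h).congr_fun fun n => ?_
  rw [RCLike.inner_apply, mul_comm]

/-- The real part of the inner product of `L²`. -/
def ip (u v : L2Circle) : ℝ := (inner ℂ u v).re

theorem hasSum_ip (u v : L2Circle) :
    HasSum (fun n : ℤ => (conj (fourierCoeff u n) * fourierCoeff v n).re) (ip u v) :=
  Complex.hasSum_re (hasSum_inner_fourierCoeff u v)

theorem hasSum_ip_self (u : L2Circle) :
    HasSum (fun n : ℤ => ‖fourierCoeff u n‖ ^ 2) (ip u u) := by
  refine (hasSum_ip u u).congr_fun fun n => ?_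
  rw [mul_comm (conj _), Complex.mul_conj, Complex.ofReal_re, Complex.normSq_eq_norm_sq]

theorem ip_comm (u v : L2Circle) : ip u v = ip v u := by
  unfold ip
  rw [← inner_conj_symm, Complex.conj_re]

theorem ip_self (u : L2Circle) : ip u u = ‖u‖ ^ 2 := inner_self_eq_norm_sq (𝕜 := ℂ) u

theorem ip_self_nonneg (u : L2Circle) : 0 ≤ ip u u := by rw [ip_self]; positivity

theorem abs_ip_le (u v : L2Circle) : |ip u v| ≤ ‖u‖ * ‖v‖ :=
  (Complex.abs_re_le_norm _).trans (norm_inner_le_norm u v)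

theorem ip_add_left (u v w : L2Circle) : ip (u + v) w = ip u w + ip v w := by
  simp [ip, inner_add_left]

theorem ip_add_right (u v w : L2Circle) : ip u (v + w) = ip u v + ip u w := by
  simp [ip, inner_add_right]

theorem ip_sub_left (u v w : L2Circle) : ip (u - v) w = ip u w - ip v w := by
  simp [ip, inner_sub_left]

theorem ip_sub_right (u v w : L2Circle) : ip u (v - w) = ip u v - ip u w := by
  simp [ip, inner_sub_right]

theorem ip_neg_left (u v : L2Circle) : ip (-u) v = -ip u v := by
  simp [ip, inner_neg_left]

theorem ip_neg_right (u v : L2Circle) : ip u (-v) = -ip u v := by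
  simp [ip, inner_neg_right]

theorem ip_smul_left (x : ℝ) (u v : L2Circle) : ip ((x : ℂ) • u) v = x * ip u v := by
  rw [ip, inner_smul_left, Complex.conj_ofReal, Complex.re_ofReal_mul, ip]

theorem ip_smul_right (x : ℝ) (u v : L2Circle) : ip u ((x : ℂ) • v) = x * ip u v := by
  rw [ip, inner_smul_right, Complex.re_ofReal_mul, ip]

theorem helmholtzInv_coeff {a : ℝ} (ha : 0 < a) (w : L2Circle) (n : ℤ) :
    fourierCoeff (helmholtzInv a w) n =
      (((a + (n : ℝ) ^ 2)⁻¹ : ℝ) : ℂ) * fourierCoeff w n := by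
  have hpos : 0 < a + (n : ℝ) ^ 2 := by positivity
  set e := LinearEquiv.ofBijective (helmholtz a) (helmholtz_bijective ha)
  have h1 : helmholtzInv a w = (e.symm w : L2Circle) := by
    simp only [helmholtzInv, dif_pos ha]
    rfl
  have h2 : helmholtz a (e.symm w) = w := e.apply_symm_apply w
  have h3 := helmholtz_coeff a (e.symm w) n
  rw [h2] at h3
  rw [h1, h3, ← mul_assoc, ← Complex.ofReal_mul, inv_mul_cancel₀ hpos.ne', Complex.ofReal_one,
    one_mul]

theorem mulSin_coe (β : ℝ) (u : L2Circle) :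
    (mulSin β u : Circle2Pi → ℂ) =ᵐ[AddCircle.haarAddCircle]
      fun t => (sinShift β t : ℂ) * u t :=
  MemLp.coeFn_toLp (memLp_sinShift_mul β u)

theorem sinShift_eq (β : ℝ) (t : Circle2Pi) :
    (sinShift β t : ℂ) = (Complex.exp (β * Complex.I) * fourier 1 t -
      Complex.exp (-(β * Complex.I)) * fourier (-1) t) / (2 * Complex.I) := by
  induction t using QuotientAddGroup.induction_on with
  | H y =>
    have h1 := fourier_eq_exp 1 y
    have h2 := fourier_eq_exp (-1) y
    have h3 : sinShift β (y : Circle2Pi) = Real.sin (y + β) := rfl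
    change ((sinShift β (y : Circle2Pi) : ℝ) : ℂ) = (_ * fourier 1 (y : Circle2Pi) -
      _ * fourier (-1) (y : Circle2Pi)) / _
    rw [h1, h2, h3, ← Complex.exp_add, ← Complex.exp_add, Complex.ofReal_sin, Complex.sin]
    have e1 : (β * Complex.I + Complex.I * ((1 : ℤ) : ℂ) * y) =
      ((y + β : ℝ) : ℂ) * Complex.I := by push_cast; ring
    have e2 : (-(β * Complex.I) + Complex.I * ((-1 : ℤ) : ℂ) * y) =
      -((y + β : ℝ) : ℂ) * Complex.I := by push_cast; ring
    rw [e1, e2]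
    field_simp
    rw [Complex.I_sq]
    ring

theorem mulSin_coeff (β : ℝ) (u : L2Circle) (n : ℤ) :
    fourierCoeff (mulSin β u) n =
      (Complex.exp (β * Complex.I) * fourierCoeff u (n - 1) -
        Complex.exp (-(β * Complex.I)) * fourierCoeff u (n + 1)) / (2 * Complex.I) := by
  have hu : Integrable (u : Circle2Pi → ℂ) AddCircle.haarAddCircle :=
    (Lp.memLp u).integrable (by norm_num)
  have hint : ∀ k : ℤ, Integrable (fun t => fourier k t • u t)
      (AddCircle.haarAddCircle (T := 2 * Real.pi)) := fun k => by
    refine hu.bdd_mul (c := 1) (fourier k).continuous.aestronglyMeasurable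
      (Filter.Eventually.of_forall fun t => ?_)
    rw [fourier_apply]
    exact (Circle.norm_coe _).le
  unfold fourierCoeff
  rw [← integral_const_mul, ← integral_const_mul, ← integral_sub ((hint _).const_mul _)
    ((hint _).const_mul _), ← integral_div]
  apply integral_congr_ae
  filter_upwards [mulSin_coe β u] with t ht
  rw [ht, sinShift_eq]
  have e1 : fourier (-(n - 1)) t = fourier 1 t * fourier (-n) t := by
    rw [← fourier_add]; congr 2; ring
  have e2 : fourier (-(n + 1)) t = fourier (-1) t * fourier (-n) t := by
    rw [← fourier_add]; congr 2; ring
  simp only [e1, e2, smul_eq_mul]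
  ring

/-- Multiplication by `cos (y + β)` on `L²(𝕋_{2π})`. -/
def mulCos (β : ℝ) : L2Circle →ₗ[ℂ] L2Circle := mulSin (β + Real.pi / 2)

theorem mulCos_coeff (β : ℝ) (u : L2Circle) (n : ℤ) :
    fourierCoeff (mulCos β u) n =
      (Complex.exp (β * Complex.I) * fourierCoeff u (n - 1) +
        Complex.exp (-(β * Complex.I)) * fourierCoeff u (n + 1)) / 2 := by
  have e0 : Complex.exp ((Real.pi / 2 : ℝ) * Complex.I) = Complex.I := by
    push_cast
    exact Complex.exp_pi_div_two_mul_I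
  have e1 : Complex.exp ((β + Real.pi / 2 : ℝ) * Complex.I) =
      Complex.exp (β * Complex.I) * Complex.I := by
    rw [Complex.ofReal_add, add_mul, Complex.exp_add, e0]
  have e2 : Complex.exp (-((β + Real.pi / 2 : ℝ) * Complex.I)) =
      -(Complex.exp (-(β * Complex.I)) * Complex.I) := by
    rw [Complex.ofReal_add, add_mul, neg_add, Complex.exp_add, Complex.exp_neg (_ * _), Complex.exp_neg ((Real.pi / 2 : ℝ) * Complex.I), e0, Complex.inv_I]
    ring
  rw [mulCos, mulSin_coeff, e1, e2]
  field_simp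
  ring

/-! ### Symmetry, commutation and product rules for the multipliers. -/

theorem inner_mulSin (β : ℝ) (u v : L2Circle) :
    inner ℂ (mulSin β u) v = inner ℂ u (mulSin β v) := by
  rw [L2.inner_def, L2.inner_def]
  apply integral_congr_ae
  filter_upwards [mulSin_coe β u, mulSin_coe β v] with t h1 h2
  rw [h1, h2]
  simp only [RCLike.inner_apply, map_mul, Complex.conj_ofReal]
  ring

theorem mulSin_comm (β γ : ℝ) (u : L2Circle) :
    mulSin β (mulSin γ u) = mulSin γ (mulSin β u) := by
  apply Lp.ext
  filter_upwards [mulSin_coe β u, mulSin_coe γ u, mulSin_coe β (mulSin γ u),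
    mulSin_coe γ (mulSin β u)] with t h1 h2 h3 h4
  rw [h3, h4, h1, h2]
  ring

theorem sinShift_sq_add_sq (β : ℝ) (t : Circle2Pi) :
    sinShift β t ^ 2 + sinShift (β + Real.pi / 2) t ^ 2 = 1 := by
  induction t using QuotientAddGroup.induction_on with
  | H y =>
    change Real.sin (y + β) ^ 2 + Real.sin (y + (β + Real.pi / 2)) ^ 2 = 1
    rw [← add_assoc, Real.sin_add_pi_div_two, Real.sin_sq_add_cos_sq]

theorem mulSin_mulSin_add_mulCos_mulCos (β : ℝ) (u : L2Circle) :
    mulSin β (mulSin β u) + mulCos β (mulCos β u) = u := by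
  apply Lp.ext
  filter_upwards [mulSin_coe β u, mulSin_coe (β + Real.pi / 2) u, mulSin_coe β (mulSin β u),
    mulSin_coe (β + Real.pi / 2) (mulSin (β + Real.pi / 2) u),
    Lp.coeFn_add (mulSin β (mulSin β u)) (mulCos β (mulCos β u))] with t h1 h2 h3 h4 h5
  rw [h5, Pi.add_apply, mulCos, h3, h4, h1, h2]
  have h := congrArg (fun x : ℝ => (x : ℂ)) (sinShift_sq_add_sq β t)
  push_cast at h
  linear_combination u t * h

theorem inner_helmholtzInv {a : ℝ} (ha : 0 < a) (u v : L2Circle) :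
    inner ℂ (helmholtzInv a u) v = inner ℂ u (helmholtzInv a v) := by
  refine (hasSum_inner_fourierCoeff _ _).unique ?_
  refine (hasSum_inner_fourierCoeff u (helmholtzInv a v)).congr_fun fun n => ?_
  simp only [helmholtzInv_coeff ha, map_mul, Complex.conj_ofReal]
  ring

theorem IsWeakDeriv.inner_eq {u u' v v' : L2Circle} (hu : IsWeakDeriv u u')
    (hv : IsWeakDeriv v v') : inner ℂ u' v = -inner ℂ u v' := by
  rw [isWeakDeriv_iff] at hu hv
  refine (hasSum_inner_fourierCoeff _ _).unique ?_
  refine ((hasSum_inner_fourierCoeff u v').neg).congr_fun fun n => ?_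
  rw [hu, hv]
  simp only [map_mul, Complex.conj_I, map_intCast]
  ring

theorem IsWeakDeriv.sub {u v u' v' : L2Circle} (h : IsWeakDeriv u u') (k : IsWeakDeriv v v') :
    IsWeakDeriv (u - v) (u' - v') := by
  rw [isWeakDeriv_iff] at *
  intro n
  rw [coeff_sub, coeff_sub, h, k]
  ring

theorem IsWeakDeriv.sin_mul {u u' : L2Circle} (h : IsWeakDeriv u u') (β : ℝ) :
    IsWeakDeriv (mulSin β u) (mulSin β u' + mulCos β u) := by
  rw [isWeakDeriv_iff] at *
  intro n
  rw [coeff_add, mulSin_coeff, mulSin_coeff, mulCos_coeff, h, h]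
  field_simp
  push_cast
  ring

theorem IsWeakDeriv.cos_mul {u u' : L2Circle} (h : IsWeakDeriv u u') (β : ℝ) :
    IsWeakDeriv (mulCos β u) (mulCos β u' - mulSin β u) := by
  rw [isWeakDeriv_iff] at *
  intro n
  rw [coeff_sub, mulSin_coeff, mulCos_coeff, mulCos_coeff, h, h]
  field_simp
  rw [Complex.I_sq]
  push_cast
  ring

theorem IsWeakDeriv.helmholtz_inv {u u' : L2Circle} (h : IsWeakDeriv u u') {a : ℝ} (ha : 0 < a) :
    IsWeakDeriv (helmholtzInv a u) (helmholtzInv a u') := by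
  rw [isWeakDeriv_iff] at *
  intro n
  rw [helmholtzInv_coeff ha, helmholtzInv_coeff ha, h]
  ring

theorem IsWeakDeriv.helmholtz_inv₂ {u u' : L2Circle} (h : IsWeakDeriv u u') {a : ℝ}
    (ha : 0 < a) :
    IsWeakDeriv (helmholtzInv a u') ((a : ℂ) • helmholtzInv a u - u) := by
  rw [isWeakDeriv_iff] at *
  intro n
  have hpos : (a : ℂ) + (n : ℂ) ^ 2 ≠ 0 := by
    have : 0 < a + (n : ℝ) ^ 2 := by positivity
    exact_mod_cast this.ne'
  rw [coeff_sub, coeff_smul, helmholtzInv_coeff ha, helmholtzInv_coeff ha, h]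
  push_cast
  field_simp
  rw [Complex.I_sq]
  ring

/-! ### The star norm -/

/-- The operator `1 - (a - ∂_y²)⁻¹`. -/
def starOp (a : ℝ) : L2Circle →ₗ[ℂ] L2Circle := LinearMap.id - helmholtzInv a

theorem starOp_apply (a : ℝ) (u : L2Circle) : starOp a u = u - helmholtzInv a u := rfl

theorem starOp_coeff {a : ℝ} (ha : 0 < a) (u : L2Circle) (n : ℤ) :
    fourierCoeff (starOp a u) n =
      ((1 - (a + (n : ℝ) ^ 2)⁻¹ : ℝ) : ℂ) * fourierCoeff u n := by
  rw [starOp_apply, coeff_sub, helmholtzInv_coeff ha]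
  push_cast
  ring

theorem inner_starOp {a : ℝ} (ha : 0 < a) (u v : L2Circle) :
    inner ℂ (starOp a u) v = inner ℂ u (starOp a v) := by
  rw [starOp_apply, starOp_apply, inner_sub_left, inner_sub_right, inner_helmholtzInv ha]

theorem IsWeakDeriv.starOp {u u' : L2Circle} (h : IsWeakDeriv u u') {a : ℝ} (ha : 0 < a) :
    IsWeakDeriv (starOp a u) (starOp a u') :=
  h.sub (h.helmholtz_inv ha)

/-- The imaginary part of the inner product of `L²`. -/
def jp (u v : L2Circle) : ℝ := (inner ℂ u v).im

theorem jp_comm (u v : L2Circle) : jp u v = -jp v u := by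
  unfold jp
  rw [← inner_conj_symm, Complex.conj_im]

theorem jp_add_left (u v w : L2Circle) : jp (u + v) w = jp u w + jp v w := by
  simp [jp, inner_add_left]

theorem jp_add_right (u v w : L2Circle) : jp u (v + w) = jp u v + jp u w := by
  simp [jp, inner_add_right]

theorem jp_sub_left (u v w : L2Circle) : jp (u - v) w = jp u w - jp v w := by
  simp [jp, inner_sub_left]

theorem jp_sub_right (u v w : L2Circle) : jp u (v - w) = jp u v - jp u w := by
  simp [jp, inner_sub_right]

theorem jp_smul_left (x : ℝ) (u v : L2Circle) : jp ((x : ℂ) • u) v = x * jp u v := by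
  rw [jp, inner_smul_left, Complex.conj_ofReal, Complex.im_ofReal_mul, jp]

theorem ip_I_smul_left (u v : L2Circle) : ip (Complex.I • u) v = jp u v := by
  simp [ip, jp, inner_smul_left]

theorem ip_I_smul_right (u v : L2Circle) : ip u (Complex.I • v) = -jp u v := by
  simp [ip, jp, inner_smul_right]

theorem jp_I_smul_left (u v : L2Circle) : jp (Complex.I • u) v = -ip u v := by
  simp [ip, jp, inner_smul_left]

theorem ip_mulSin (β : ℝ) (u v : L2Circle) : ip (mulSin β u) v = ip u (mulSin β v) := by
  rw [ip, inner_mulSin, ip]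

theorem ip_mulCos (β : ℝ) (u v : L2Circle) : ip (mulCos β u) v = ip u (mulCos β v) :=
  ip_mulSin _ u v

theorem jp_mulSin (β : ℝ) (u v : L2Circle) : jp (mulSin β u) v = jp u (mulSin β v) := by
  rw [jp, inner_mulSin, jp]

theorem ip_starOp {a : ℝ} (ha : 0 < a) (u v : L2Circle) :
    ip (starOp a u) v = ip u (starOp a v) := by
  rw [ip, inner_starOp ha, ip]

theorem jp_starOp {a : ℝ} (ha : 0 < a) (u v : L2Circle) :
    jp (starOp a u) v = jp u (starOp a v) := by
  rw [jp, inner_starOp ha, jp]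

theorem ip_helmholtzInv {a : ℝ} (ha : 0 < a) (u v : L2Circle) :
    ip (helmholtzInv a u) v = ip u (helmholtzInv a v) := by
  rw [ip, inner_helmholtzInv ha, ip]

theorem IsWeakDeriv.ip_eq {u u' v v' : L2Circle} (hu : IsWeakDeriv u u')
    (hv : IsWeakDeriv v v') : ip u' v = -ip u v' := by
  rw [ip, hu.inner_eq hv, Complex.neg_re, ip]

theorem IsWeakDeriv.jp_eq {u u' v v' : L2Circle} (hu : IsWeakDeriv u u')
    (hv : IsWeakDeriv v v') : jp u' v = -jp u v' := by
  rw [jp, hu.inner_eq hv, Complex.neg_im, jp]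

theorem jp_mulSin_self (β : ℝ) (u : L2Circle) : jp (mulSin β u) u = 0 := by
  have h1 := jp_mulSin β u u
  have h2 := jp_comm u (mulSin β u)
  linarith

theorem jp_starOp_self {a : ℝ} (ha : 0 < a) (u : L2Circle) : jp u (starOp a u) = 0 := by
  have h1 := jp_starOp ha u u
  have h2 := jp_comm u (starOp a u)
  linarith

theorem norm_sq_mulSin_add_norm_sq_mulCos (β : ℝ) (u : L2Circle) :
    ‖mulSin β u‖ ^ 2 + ‖mulCos β u‖ ^ 2 = ‖u‖ ^ 2 := by
  rw [← ip_self, ← ip_self, ← ip_self, ip_mulSin, ip_mulCos, ← ip_add_right,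
    mulSin_mulSin_add_mulCos_mulCos]

theorem norm_mulSin_le (β : ℝ) (u : L2Circle) : ‖mulSin β u‖ ≤ ‖u‖ := by
  have h := norm_sq_mulSin_add_norm_sq_mulCos β u
  exact le_of_sq_le_sq (by nlinarith [sq_nonneg ‖mulCos β u‖]) (norm_nonneg _)

theorem norm_mulCos_le (β : ℝ) (u : L2Circle) : ‖mulCos β u‖ ≤ ‖u‖ :=
  norm_mulSin_le _ u

theorem inv_add_sq_le {a : ℝ} (ha : 0 < a) (n : ℤ) : (a + (n : ℝ) ^ 2)⁻¹ ≤ a⁻¹ :=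
  inv_anti₀ ha (by nlinarith [sq_nonneg (n : ℝ)])

/-- For `a > 1` the symbol of `S` lies in `[0, 1]`, so `S` has a bounded square root. It turns the
star form into an `L²` inner product and yields Cauchy–Schwarz for it. -/
theorem exists_sqrt_starOp {a : ℝ} (ha : 1 < a) (u : L2Circle) :
    ∃ p : L2Circle, ∀ n : ℤ, fourierCoeff p n =
      ((Real.sqrt (1 - (a + (n : ℝ) ^ 2)⁻¹) : ℝ) : ℂ) * fourierCoeff u n := by
  refine exists_multiplier _ 1 (fun n => ?_) u
  have h : 0 < a + (n : ℝ) ^ 2 := by positivity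
  rw [Complex.norm_real, Real.norm_eq_abs, abs_of_nonneg (Real.sqrt_nonneg _)]
  exact Real.sqrt_le_one.2 (by linarith [inv_pos.2 h])

theorem one_sub_inv_nonneg {a : ℝ} (ha : 1 < a) (n : ℤ) : 0 ≤ 1 - (a + (n : ℝ) ^ 2)⁻¹ := by
  have h1 := inv_add_sq_le (by linarith : 0 < a) n
  have h2 := inv_lt_one_of_one_lt₀ ha
  linarith

theorem ip_starOp_eq {a : ℝ} (ha : 1 < a) {u v p q : L2Circle}
    (hp : ∀ n : ℤ, fourierCoeff p n =
      ((Real.sqrt (1 - (a + (n : ℝ) ^ 2)⁻¹) : ℝ) : ℂ) * fourierCoeff u n)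
    (hq : ∀ n : ℤ, fourierCoeff q n =
      ((Real.sqrt (1 - (a + (n : ℝ) ^ 2)⁻¹) : ℝ) : ℂ) * fourierCoeff v n) :
    ip u (starOp a v) = ip p q := by
  refine (hasSum_ip _ _).unique ((hasSum_ip p q).congr_fun fun n => ?_)
  rw [starOp_coeff (by linarith), hp, hq]
  have h := Real.mul_self_sqrt (one_sub_inv_nonneg ha n)
  nth_rw 1 [← h]
  simp only [map_mul, Complex.conj_ofReal, Complex.ofReal_mul]
  ring_nf

theorem starNorm_eq {a : ℝ} (u : L2Circle) :
    starNorm a u = Real.sqrt (ip u (starOp a u)) := by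
  rw [ip_comm]
  rfl

theorem starNorm_nonneg (a : ℝ) (u : L2Circle) : 0 ≤ starNorm a u := Real.sqrt_nonneg _

theorem starNorm_sq {a : ℝ} (ha : 1 < a) (u : L2Circle) :
    starNorm a u ^ 2 = ip u (starOp a u) := by
  obtain ⟨p, hp⟩ := exists_sqrt_starOp ha u
  rw [starNorm_eq, Real.sq_sqrt]
  rw [ip_starOp_eq ha hp hp]
  exact ip_self_nonneg p

theorem abs_ip_starOp_le {a : ℝ} (ha : 1 < a) (u v : L2Circle) :
    |ip u (starOp a v)| ≤ starNorm a u * starNorm a v := by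
  obtain ⟨p, hp⟩ := exists_sqrt_starOp ha u
  obtain ⟨q, hq⟩ := exists_sqrt_starOp ha v
  rw [starNorm_eq, starNorm_eq, ip_starOp_eq ha hp hq, ip_starOp_eq ha hp hp,
    ip_starOp_eq ha hq hq, ip_self, ip_self, Real.sqrt_sq (norm_nonneg _),
    Real.sqrt_sq (norm_nonneg _)]
  exact abs_ip_le p q

theorem starNorm_I_smul {a : ℝ} (u : L2Circle) : starNorm a (Complex.I • u) = starNorm a u := by
  rw [starNorm_eq, starNorm_eq, map_smul, ip_I_smul_left, jp_comm, jp_I_smul_left, neg_neg,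
    ip_comm]

theorem starNorm_smul {a : ℝ} (x : ℝ) (u : L2Circle) :
    starNorm a ((x : ℂ) • u) = |x| * starNorm a u := by
  rw [starNorm_eq, starNorm_eq, map_smul, ip_smul_left, ip_smul_right, ← mul_assoc, ← pow_two,
    Real.sqrt_mul (sq_nonneg x), Real.sqrt_sq_eq_abs]

theorem abs_jp_starOp_le {a : ℝ} (ha : 1 < a) (u v : L2Circle) :
    |jp u (starOp a v)| ≤ starNorm a u * starNorm a v := by
  rw [← ip_I_smul_left, ← starNorm_I_smul u]
  exact abs_ip_starOp_le ha _ v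

theorem ip_helmholtzInv_self_nonneg {a : ℝ} (ha : 0 < a) (u : L2Circle) :
    0 ≤ ip u (helmholtzInv a u) := by
  refine (hasSum_ip u (helmholtzInv a u)).nonneg fun n => ?_
  rw [helmholtzInv_coeff ha, mul_left_comm, mul_comm (conj _), Complex.mul_conj,
    ← Complex.ofReal_mul, Complex.ofReal_re]
  have := Complex.normSq_nonneg (fourierCoeff u n)
  positivity

theorem ip_helmholtzInv_starOp_nonneg {a : ℝ} (ha : 1 < a) (u : L2Circle) :
    0 ≤ ip (helmholtzInv a u) (starOp a u) := by
  refine (hasSum_ip (helmholtzInv a u) (starOp a u)).nonneg fun n => ?_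
  rw [helmholtzInv_coeff (by linarith), starOp_coeff (by linarith), map_mul, Complex.conj_ofReal,
    mul_mul_mul_comm, mul_comm (conj _), Complex.mul_conj, ← Complex.ofReal_mul,
    ← Complex.ofReal_mul, Complex.ofReal_re]
  have h1 := Complex.normSq_nonneg (fourierCoeff u n)
  have h2 := one_sub_inv_nonneg ha n
  positivity

/-- Split `u = S u + H u`. For a unit vector this is the decomposition of `1` that the final
contradiction targets. -/
theorem starNorm_sq_eq_norm_sq_add {a : ℝ} (ha : 1 < a) (u : L2Circle) :
    starNorm a u ^ 2 = ‖starOp a u‖ ^ 2 + ip (helmholtzInv a u) (starOp a u) := by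
  rw [starNorm_sq ha, ← ip_self, ← ip_add_left]
  congr 1
  rw [starOp_apply, sub_add_cancel]

theorem norm_starOp_le_starNorm {a : ℝ} (ha : 1 < a) (u : L2Circle) :
    ‖starOp a u‖ ≤ starNorm a u := by
  have h1 := starNorm_sq_eq_norm_sq_add ha u
  have h2 := ip_helmholtzInv_starOp_nonneg ha u
  exact le_of_sq_le_sq (by linarith) (starNorm_nonneg a u)

theorem starNorm_le_norm {a : ℝ} (ha : 1 < a) (u : L2Circle) : starNorm a u ≤ ‖u‖ := by
  have h1 := starNorm_sq ha u
  have h2 := ip_helmholtzInv_self_nonneg (by linarith : 0 < a) u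
  rw [starOp_apply, ip_sub_right, ip_self] at h1
  exact le_of_sq_le_sq (by linarith) (norm_nonneg u)

theorem starNorm_mulSin_starOp_le {a : ℝ} (ha : 1 < a) (β : ℝ) (u : L2Circle) :
    starNorm a (mulSin β (starOp a u)) ≤ starNorm a u :=
  (starNorm_le_norm ha _).trans ((norm_mulSin_le β _).trans (norm_starOp_le_starNorm ha u))

/-! ### Energy identities for the resolvent equation -/

/-- The equation `-ε u'' + i (sin (y + β) (1 - (a - ∂_y²)⁻¹) u - l u) = F`, where `u₁` and `u₂` are
the first two derivatives of `u`. -/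
structure IsResolventSol (a β ε l : ℝ) (u u₁ u₂ F : L2Circle) : Prop where
  one_lt : 1 < a
  pos : 0 < ε
  deriv₁ : IsWeakDeriv u u₁
  deriv₂ : IsWeakDeriv u₁ u₂
  eq : F = Complex.I • (mulSin β (starOp a u) - (l : ℂ) • u) - (ε : ℂ) • u₂

namespace IsResolventSol

variable {a β ε l : ℝ} {u u₁ u₂ F : L2Circle}

theorem a_pos (h : IsResolventSol a β ε l u u₁ u₂ F) : 0 < a := by linarith [h.one_lt]

theorem derivW (h : IsResolventSol a β ε l u u₁ u₂ F) :
    IsWeakDeriv (starOp a u) (starOp a u₁) := h.deriv₁.starOp h.a_pos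

theorem derivW₂ (h : IsResolventSol a β ε l u u₁ u₂ F) :
    IsWeakDeriv (starOp a u₁) (starOp a u₂) := h.deriv₂.starOp h.a_pos

/-- Paired with `S u`, the transport part is `i` times a real number, by symmetry, so only the
viscous term survives. -/
theorem energy (h : IsResolventSol a β ε l u u₁ u₂ F) :
    ε * starNorm a u₁ ^ 2 ≤ starNorm a F * starNorm a u := by
  have h1 : ip F (starOp a u) = ε * starNorm a u₁ ^ 2 := by
    rw [h.eq, ip_sub_left, ip_I_smul_left, jp_sub_left, jp_smul_left, ip_smul_left,
      jp_mulSin_self, jp_starOp_self h.a_pos, h.deriv₂.ip_eq h.derivW, starNorm_sq h.one_lt]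
    ring
  rw [← h1]
  exact (le_abs_self _).trans (abs_ip_starOp_le h.one_lt F u)

/-- Pairing with `S u''` and integrating by parts once leaves from the transport only the derivative
falling on the sine, namely `cos w` against `S u'`. -/
theorem second_order (h : IsResolventSol a β ε l u u₁ u₂ F) :
    ε * starNorm a u₂ ^ 2 ≤ starNorm a F * starNorm a u₂ +
      starNorm a (mulCos β (starOp a u)) * starNorm a u₁ := by
  have h1 : ip F (starOp a u₂) = -ε * starNorm a u₂ ^ 2 -
      jp (mulCos β (starOp a u)) (starOp a u₁) := by
    have e1 := (h.derivW.sin_mul β).jp_eq h.derivW₂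
    have e2 := h.deriv₁.jp_eq h.derivW₂
    rw [jp_starOp_self h.a_pos] at e2
    rw [jp_add_left, jp_mulSin_self] at e1
    rw [h.eq, ip_sub_left, ip_I_smul_left, jp_sub_left, jp_smul_left, ip_smul_left,
      starNorm_sq h.one_lt]
    linear_combination e1 - l * e2
  have h2 := neg_abs_le (ip F (starOp a u₂))
  have h3 := abs_ip_starOp_le h.one_lt F u₂
  have h4 := neg_abs_le (jp (mulCos β (starOp a u)) (starOp a u₁))
  have h5 := abs_jp_starOp_le h.one_lt (mulCos β (starOp a u)) u₁
  linarith

theorem ip_starOp_mulSin_mulCos (h : IsResolventSol a β ε l u u₁ u₂ F) :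
    ip (mulSin β (starOp a u₁)) (starOp a (mulCos β (starOp a u))) +
      ip (mulCos β (starOp a u₁)) (starOp a (mulSin β (starOp a u))) =
    starNorm a (mulSin β (starOp a u)) ^ 2 - starNorm a (mulCos β (starOp a u)) ^ 2 := by
  have e := (h.derivW.sin_mul β).ip_eq ((h.derivW.cos_mul β).starOp h.a_pos)
  rw [starNorm_sq h.one_lt, starNorm_sq h.one_lt]
  rw [map_sub, ip_sub_right, ip_add_left] at e
  have e2 : ip (mulSin β (starOp a u)) (starOp a (mulCos β (starOp a u₁))) =
    ip (mulCos β (starOp a u₁)) (starOp a (mulSin β (starOp a u))) := by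
    rw [← ip_starOp h.a_pos, ip_comm]
  linarith

theorem I_smul_eq (h : IsResolventSol a β ε l u u₁ u₂ F) :
    mulSin β (starOp a u) - (l : ℂ) • u = -(Complex.I • (F + (ε : ℂ) • u₂)) := by
  rw [h.eq, sub_add_cancel, smul_smul, Complex.I_mul_I, neg_one_smul, neg_neg]

theorem jp_commute (ha : 0 < a) (v : L2Circle) :
    jp v (starOp a (mulSin β (starOp a v))) = 0 := by
  rw [← jp_starOp ha, ← jp_mulSin]
  exact jp_mulSin_self β _

/-- The test function is `u - y = (1 - T²) u`, the nonlocal analogue of `cos² u`, and `⟨F, S(u -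
y)⟩` is evaluated twice. Through the equation it yields the viscous term. Through `(T - l) u = -i (F
+ ε u'')` it becomes `(1 - l²)` times a harmless term plus small ones. -/
theorem cos_deriv (h : IsResolventSol a β ε l u u₁ u₂ F) :
    ε * ‖mulCos β (starOp a u₁)‖ ^ 2 ≤ |1 - l ^ 2| * (starNorm a F * starNorm a u) +
      (1 + |l|) * (starNorm a F * (ε * starNorm a u₂)) + ε * ‖starOp a u‖ ^ 2 := by
  have ha := h.a_pos
  set w := starOp a u with hw
  set w₁ := starOp a u₁ with hw₁
  set b := mulSin β w with hb
  set y := mulSin β (starOp a b) with hy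
  set G := b - (l : ℂ) • u with hG
  have dy : IsWeakDeriv y (mulSin β (starOp a (mulSin β w₁ + mulCos β w)) +
      mulCos β (starOp a b)) := ((h.derivW.sin_mul β).starOp ha).sin_mul β
  have i1 : ip F (starOp a (u - y)) = ε * (starNorm a u₁ ^ 2 - starNorm a (mulSin β w₁) ^ 2 -
      (starNorm a b ^ 2 - starNorm a (mulCos β w) ^ 2)) := by
    -- Polynomials in `T` are symmetric for the star form and commute, so the transport term has no
    -- imaginary part.
    have z1 : jp G (starOp a (u - y)) = 0 := by
      have j1 : jp b w = 0 := jp_mulSin_self β w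
      have j2 : jp b (starOp a y) = 0 := by
        rw [← jp_starOp ha, hy, ← jp_mulSin]
        exact jp_mulSin_self β _
      have j3 : jp u w = 0 := jp_starOp_self ha u
      have j4 : jp u (starOp a y) = 0 := by
        rw [← jp_starOp ha, hy, ← jp_mulSin]
        exact jp_starOp_self ha b
      rw [map_sub, jp_sub_right, hG, jp_sub_left, jp_sub_left, jp_smul_left, jp_smul_left, j1, j2,
        j3, j4]
      ring
    have z2 := h.deriv₂.ip_eq ((h.deriv₁.sub dy).starOp ha)
    have z3 := h.ip_starOp_mulSin_mulCos
    rw [← hw, ← hw₁, ← hb] at z3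
    rw [map_sub, ip_sub_right, map_sub, ip_sub_right, ← ip_starOp ha u₁ (_ + _), ← hw₁, ip_add_right, ← ip_mulSin,
      ← ip_mulCos, map_add, ip_add_right, ← starNorm_sq h.one_lt, ← starNorm_sq h.one_lt] at z2
    rw [h.eq, ip_sub_left, ip_I_smul_left, ip_smul_left, z1, map_sub, ip_sub_right, z2]
    linear_combination (-ε) * z3
  have i2 : ip F (starOp a (u - y)) = (1 - l ^ 2) * ip F w +
      ε * (l * ip F (starOp a (Complex.I • u₂)) +
        ip F (starOp a (mulSin β (starOp a (Complex.I • u₂))))) := by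
    -- This is `1 - T² = (1 - l²) - l (T - l) - T (T - l)` applied to `u`.
    have g1 : u - y = ((1 - l ^ 2 : ℝ) : ℂ) • u - (l : ℂ) • G - mulSin β (starOp a G) := by
      rw [hG, map_sub, map_sub, map_smul, map_smul, ← hw, ← hb, ← hy]
      push_cast
      module
    have g2 : G = -(Complex.I • F) - (ε : ℂ) • (Complex.I • u₂) := by
      rw [show G = _ from h.I_smul_eq, smul_add, smul_comm]
      abel
    have g3 : ip F (starOp a (Complex.I • F)) = 0 := by
      rw [map_smul, ip_I_smul_right, jp_starOp_self ha, neg_zero]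
    have g4 : ip F (starOp a (mulSin β (starOp a (Complex.I • F)))) = 0 := by
      rw [map_smul, map_smul, map_smul, ip_I_smul_right, jp_commute ha, neg_zero]
    rw [g1, g2]
    simp only [map_sub, map_neg, ip_sub_right, ip_neg_right, smul_sub, smul_neg]
    simp only [map_smul (starOp a) (l : ℂ), map_smul (starOp a) (ε : ℂ),
      map_smul (mulSin β) (ε : ℂ), map_smul (starOp a) ((1 - l ^ 2 : ℝ) : ℂ)]
    simp only [ip_smul_right, g3, g4]
    ring
  have b1 := abs_ip_starOp_le h.one_lt F u
  have b2 := abs_ip_starOp_le h.one_lt F (Complex.I • u₂)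
  have b3 := abs_ip_starOp_le h.one_lt F (mulSin β (starOp a (Complex.I • u₂)))
  have b4 := starNorm_mulSin_starOp_le h.one_lt β (Complex.I • u₂)
  have b5 : |ip F (starOp a (mulSin β (starOp a (Complex.I • u₂))))| ≤
      starNorm a F * starNorm a u₂ := by
    rw [starNorm_I_smul] at b4
    exact b3.trans (mul_le_mul_of_nonneg_left b4 (starNorm_nonneg a F))
  rw [starNorm_I_smul] at b2
  have c1 : ip F (starOp a (u - y)) ≤ |1 - l ^ 2| * (starNorm a F * starNorm a u) +
      ε * (|l| * (starNorm a F * starNorm a u₂) + starNorm a F * starNorm a u₂) := by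
    rw [i2]
    have p1 : (1 - l ^ 2) * ip F w ≤ |1 - l ^ 2| * (starNorm a F * starNorm a u) :=
      (le_abs_self _).trans (by rw [abs_mul]; gcongr)
    have p2 : l * ip F (starOp a (Complex.I • u₂)) ≤ |l| * (starNorm a F * starNorm a u₂) :=
      (le_abs_self _).trans (by rw [abs_mul]; gcongr)
    have p3 := (le_abs_self _).trans b5
    have := h.pos
    gcongr
  have d1 := norm_sq_mulSin_add_norm_sq_mulCos β w₁
  have d2 := norm_starOp_le_starNorm h.one_lt u₁
  have d3 := starNorm_le_norm h.one_lt (mulSin β w₁)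
  have d4 := (starNorm_le_norm h.one_lt b).trans (norm_mulSin_le β w)
  have s1 : ‖w₁‖ ^ 2 ≤ starNorm a u₁ ^ 2 := pow_le_pow_left₀ (norm_nonneg _) d2 2
  have s2 := pow_le_pow_left₀ (starNorm_nonneg a _) d3 2
  have s3 := pow_le_pow_left₀ (starNorm_nonneg a _) d4 2
  -- Since `‖u'‖_* ≥ ‖w'‖` and `‖sin w'‖_* ≤ ‖sin w'‖`, the difference of their squares dominates
  -- `‖cos w'‖²`.
  have d5 : ε * (‖mulCos β w₁‖ ^ 2 - ‖w‖ ^ 2) ≤ ip F (starOp a (u - y)) := by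
    rw [i1]
    refine mul_le_mul_of_nonneg_left ?_ h.pos.le
    nlinarith [sq_nonneg (starNorm a (mulCos β w))]
  linarith

end IsResolventSol

/-! ### Coercivity of the commutator -/

theorem IsWeakDeriv.two_mul_ip_mulSin_mulCos {w w₁ : L2Circle} (h : IsWeakDeriv w w₁) (β : ℝ) :
    2 * ip (mulSin β w) (mulCos β w₁) = ‖mulSin β w‖ ^ 2 - ‖mulCos β w‖ ^ 2 := by
  have e := (h.sin_mul β).ip_eq (h.cos_mul β)
  rw [ip_add_left, ip_sub_right, ip_self, ip_self] at e
  have e2 : ip (mulSin β w₁) (mulCos β w) = ip (mulSin β w) (mulCos β w₁) := by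
    rw [ip_mulSin, ip_mulSin, mulCos, mulSin_comm, ← ip_mulSin, ip_comm, mulSin_comm,
      ip_mulSin, mulSin_comm]
  linarith

/-- An uncertainty principle: mass near the zeros of the cosine costs derivative. It follows from
`∂(sin cos) = cos² - sin²` by integrating by parts. -/
theorem IsWeakDeriv.norm_sq_le {w w₁ : L2Circle} (h : IsWeakDeriv w w₁) (β : ℝ) :
    ‖w‖ ^ 2 ≤ 2 * ‖mulCos β w‖ ^ 2 + 2 * (‖mulCos β w‖ * ‖w₁‖) := by
  have e1 := h.two_mul_ip_mulSin_mulCos β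
  have e2 : ip (mulSin β w) (mulCos β w₁) = ip (mulCos β w) (mulSin β w₁) := by
    rw [ip_mulSin, ip_mulCos, mulCos, mulSin_comm]
  have e3 := (le_abs_self _).trans (abs_ip_le (mulCos β w) (mulSin β w₁))
  have e4 := mul_le_mul_of_nonneg_left (norm_mulSin_le β w₁) (norm_nonneg (mulCos β w))
  have e5 := norm_sq_mulSin_add_norm_sq_mulCos β w
  linarith

/-- The lower order part of the commutator of `cos (y + β) ∂_y` with
`sin (y + β) (1 - (a - ∂_y²)⁻¹)`, evaluated at `w` with derivative `w₁`. -/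
def commForm (a β : ℝ) (w w₁ : L2Circle) : ℝ :=
  2 * ip (helmholtzInv a (mulSin β w)) (mulCos β w₁ - mulSin β w) +
    ip (helmholtzInv a (mulSin β w)) (mulSin β w) + ip (helmholtzInv a (mulCos β w)) (mulCos β w)

/-- Here `p` and `q` stand for the rotated coefficients at `n - 1` and `n + 1`. The cross terms in
`p`, `q` cancel, which is why `commForm` is diagonal. -/
theorem re_commutator_mode (p q : ℂ) (n r : ℝ) :
    2 * (conj ((r : ℂ) * ((p - q) / (2 * Complex.I))) * (Complex.I * n * ((p + q) / 2))).re +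
      (conj ((r : ℂ) * ((p - q) / (2 * Complex.I))) * ((p - q) / (2 * Complex.I))).re +
      (conj ((r : ℂ) * ((p + q) / 2)) * ((p + q) / 2)).re =
    1 / 2 * r * ((1 - n) * ‖p‖ ^ 2 + (1 + n) * ‖q‖ ^ 2) := by
  have h : (p - q) / (2 * Complex.I) = ((1 / 2 : ℝ) : ℂ) * (Complex.I * (q - p)) := by
    push_cast
    field_simp
    rw [Complex.I_sq]
    ring
  have h' : (p + q) / 2 = ((1 / 2 : ℝ) : ℂ) * (p + q) := by
    push_cast
    ring
  rw [h, h', ← Complex.normSq_eq_norm_sq, ← Complex.normSq_eq_norm_sq, Complex.normSq_apply,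
    Complex.normSq_apply]
  simp only [map_mul, map_add, map_sub, Complex.mul_re, Complex.mul_im, Complex.add_re,
    Complex.add_im, Complex.sub_re, Complex.sub_im, Complex.I_re, Complex.I_im, Complex.conj_re,
    Complex.conj_im, Complex.ofReal_re, Complex.ofReal_im, Complex.conj_ofReal]
  ring

/-- The quadratic decay of the resolvent symbol absorbs the factor `n`, so the two neighbour sums
converge separately and may be shifted. -/
theorem summable_mode {a : ℝ} (ha : 1 < a) (w : L2Circle) (k : ℤ) (hk : |(k : ℝ)| ≤ 1) (x : ℝ) :
    Summable fun n : ℤ =>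
      x * ((a + ((n + k : ℤ) : ℝ) ^ 2)⁻¹ * (n : ℝ)) * ‖fourierCoeff w n‖ ^ 2 := by
  refine Summable.of_norm_bounded ((hasSum_ip_self w).summable.mul_left (|x| * 2)) fun n => ?_
  have hpos : 0 < a + ((n + k : ℤ) : ℝ) ^ 2 := by positivity
  rw [norm_mul, norm_mul, norm_mul, Real.norm_eq_abs, Real.norm_eq_abs, Real.norm_eq_abs,
    Real.norm_eq_abs, abs_of_nonneg (sq_nonneg ‖fourierCoeff w n‖), abs_of_pos (inv_pos.2 hpos)]
  gcongr
  rw [inv_mul_le_iff₀ hpos]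
  push_cast
  have h1 : |(n : ℝ)| ≤ |(n : ℝ) + k| + 1 := by
    have := abs_sub ((n : ℝ) + k) k
    rw [add_sub_cancel_right] at this
    linarith
  nlinarith [sq_abs ((n : ℝ) + k), sq_nonneg (|(n : ℝ) + k| - 1)]

theorem norm_exp_mul_I_mul (β : ℝ) (z : ℂ) : ‖Complex.exp (β * Complex.I) * z‖ = ‖z‖ := by
  rw [norm_mul, Complex.norm_exp_ofReal_mul_I, one_mul]

theorem norm_exp_neg_mul_I_mul (β : ℝ) (z : ℂ) :
    ‖Complex.exp (-(β * Complex.I)) * z‖ = ‖z‖ := by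
  have := norm_exp_mul_I_mul (-β) z
  rwa [Complex.ofReal_neg, neg_mul] at this

theorem IsWeakDeriv.hasSum_commForm {w w₁ : L2Circle} (h : IsWeakDeriv w w₁) {a : ℝ} (ha : 1 < a)
    (β : ℝ) :
    HasSum (fun n : ℤ => 2 * (n : ℝ) ^ 2 * ((a + ((n : ℝ) - 1) ^ 2)⁻¹ *
      (a + ((n : ℝ) + 1) ^ 2)⁻¹) * ‖fourierCoeff w n‖ ^ 2) (commForm a β w w₁) := by
  have ha0 : 0 < a := by linarith
  have dz := (isWeakDeriv_iff _ _).1 (h.cos_mul β)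
  have s0 := (((hasSum_ip (helmholtzInv a (mulSin β w)) (mulCos β w₁ - mulSin β w)).mul_left
    2).add (hasSum_ip (helmholtzInv a (mulSin β w)) (mulSin β w))).add
    (hasSum_ip (helmholtzInv a (mulCos β w)) (mulCos β w))
  set g₁ : ℤ → ℝ := fun n =>
    (-(1 / 2)) * ((a + ((n + 1 : ℤ) : ℝ) ^ 2)⁻¹ * (n : ℝ)) * ‖fourierCoeff w n‖ ^ 2 with hg₁
  set g₂ : ℤ → ℝ := fun n =>
    (1 / 2) * ((a + ((n + -1 : ℤ) : ℝ) ^ 2)⁻¹ * (n : ℝ)) * ‖fourierCoeff w n‖ ^ 2 with hg₂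
  have s1 := (summable_mode ha w 1 (by norm_num) (-(1 / 2))).hasSum
  have s2 := (summable_mode ha w (-1) (by norm_num) (1 / 2)).hasSum
  -- After these shifts mode `n` carries `n/2` times the difference of the inverses of `a + (n-1)²`
  -- and `a + (n+1)²`, whose numerator is `4n`.
  have s1' := (Equiv.subRight (1 : ℤ)).hasSum_iff.2 s1
  have s2' := (Equiv.addRight (1 : ℤ)).hasSum_iff.2 s2
  have s3 : HasSum _ (commForm a β w w₁) := s0
  have s4 := s3.unique ((s1'.add s2').congr_fun fun n => by
    rw [helmholtzInv_coeff ha0, helmholtzInv_coeff ha0, dz, mulSin_coeff, mulCos_coeff]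
    have := re_commutator_mode (Complex.exp (β * Complex.I) * fourierCoeff w (n - 1))
      (Complex.exp (-(β * Complex.I)) * fourierCoeff w (n + 1)) n (a + (n : ℝ) ^ 2)⁻¹
    rw [norm_exp_mul_I_mul, norm_exp_neg_mul_I_mul] at this
    push_cast at this ⊢
    rw [this]
    simp only [Function.comp, Equiv.subRight_apply, Equiv.coe_addRight]
    push_cast
    rw [sub_add_cancel, add_neg_cancel_right]
    ring)
  rw [s4]
  refine (s1.add s2).congr_fun fun n => ?_
  have p1 : a + ((n : ℝ) - 1) ^ 2 ≠ 0 := by positivity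
  have p2 : a + ((n : ℝ) + 1) ^ 2 ≠ 0 := by positivity
  push_cast
  rw [← sub_eq_add_neg]
  field_simp
  ring

theorem IsWeakDeriv.commForm_nonneg {w w₁ : L2Circle} (h : IsWeakDeriv w w₁) {a : ℝ} (ha : 1 < a)
    (β : ℝ) : 0 ≤ commForm a β w w₁ := by
  refine (h.hasSum_commForm ha β).nonneg fun n => ?_
  have : 0 < a := by linarith
  positivity

/-- Mode by mode, since `(a+(n-1)²)(a+(n+1)²) ≤ (a+n²+1)² ≤ 4(a+n²)²` for `a > 1`. -/
theorem IsWeakDeriv.norm_sq_helmholtzInv_le {w w₁ : L2Circle} (h : IsWeakDeriv w w₁) {a : ℝ}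
    (ha : 1 < a) (β : ℝ) : ‖helmholtzInv a w₁‖ ^ 2 ≤ 2 * commForm a β w w₁ := by
  have ha0 : 0 < a := by linarith
  rw [← ip_self]
  refine hasSum_le (fun n => ?_) (hasSum_ip_self _) ((h.hasSum_commForm ha β).mul_left 2)
  have p0 : 0 < a + (n : ℝ) ^ 2 := by positivity
  have p1 : 0 < a + ((n : ℝ) - 1) ^ 2 := by positivity
  have p2 : 0 < a + ((n : ℝ) + 1) ^ 2 := by positivity
  rw [helmholtzInv_coeff ha0, (isWeakDeriv_iff _ _).1 h, norm_mul, norm_mul, norm_mul,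
    Complex.norm_I, Complex.norm_real, Real.norm_eq_abs, abs_of_pos (inv_pos.2 p0),
    Complex.norm_intCast, one_mul, mul_pow, mul_pow, sq_abs]
  have key : ((a + (n : ℝ) ^ 2)⁻¹) ^ 2 ≤
      4 * ((a + ((n : ℝ) - 1) ^ 2)⁻¹ * (a + ((n : ℝ) + 1) ^ 2)⁻¹) := by
    rw [← mul_inv, inv_pow, ← div_eq_mul_inv, inv_eq_one_div, div_le_div_iff₀ (by positivity)
      (by positivity)]
    nlinarith [sq_nonneg (n : ℝ)]
  have := mul_le_mul_of_nonneg_right key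
    (by positivity : 0 ≤ (n : ℝ) ^ 2 * ‖fourierCoeff w n‖ ^ 2)
  linarith

theorem norm_sq_mulCos_coeff_zero_le (β : ℝ) (w : L2Circle) :
    ‖fourierCoeff (mulCos β w) 0‖ ^ 2 ≤
      1 / 2 * (‖fourierCoeff w 1‖ ^ 2 + ‖fourierCoeff w (-1)‖ ^ 2) := by
  rw [mulCos_coeff, norm_div, zero_sub, zero_add]
  have h := norm_add_le (Complex.exp (β * Complex.I) * fourierCoeff w (-1))
    (Complex.exp (-(β * Complex.I)) * fourierCoeff w 1)
  rw [norm_exp_mul_I_mul, norm_exp_neg_mul_I_mul] at h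
  have h2 := pow_le_pow_left₀ (norm_nonneg _) h 2
  rw [div_pow, Complex.norm_ofNat]
  nlinarith [sq_nonneg (‖fourierCoeff w 1‖ - ‖fourierCoeff w (-1)‖)]

theorem ip_helmholtzInv_self_eq {a : ℝ} (ha : 0 < a) (u : L2Circle) :
    HasSum (fun n : ℤ => (a + (n : ℝ) ^ 2)⁻¹ * ‖fourierCoeff u n‖ ^ 2)
      (ip u (helmholtzInv a u)) := by
  refine (hasSum_ip u (helmholtzInv a u)).congr_fun fun n => ?_
  rw [helmholtzInv_coeff ha, mul_left_comm, mul_comm (conj _), Complex.mul_conj,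
    ← Complex.ofReal_mul, Complex.ofReal_re, Complex.normSq_eq_norm_sq]

/-- The symbol of `H` is at most `1/2` except at mode `0` when `a < 2`. The zero mode of `cos w`
sees only modes `±1` of `w`, where `commForm` is bounded below uniformly in such `a`. -/
theorem IsWeakDeriv.ip_mulCos_helmholtzInv_le {w w₁ : L2Circle} (h : IsWeakDeriv w w₁) {a : ℝ}
    (ha : 1 < a) (β : ℝ) :
    ip (mulCos β w) (helmholtzInv a (mulCos β w)) ≤
      1 / 2 * ‖mulCos β w‖ ^ 2 + 3 * commForm a β w w₁ := by
  have ha0 : 0 < a := by linarith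
  have s1 := ip_helmholtzInv_self_eq ha0 (mulCos β w)
  have s2 := (hasSum_ip_self (mulCos β w)).mul_left (1 / 2)
  rw [ip_self] at s2
  rcases le_or_gt 2 a with h2 | h2
  · have := hasSum_le (fun n => ?_) s1 s2
    · linarith [h.commForm_nonneg ha β]
    · refine mul_le_mul_of_nonneg_right ((inv_add_sq_le ha0 n).trans ?_) (by positivity)
      rw [← one_div]
      exact one_div_le_one_div_of_le (by norm_num) h2
  · have s3 := hasSum_ite_eq (0 : ℤ) (1 / 2 * ‖fourierCoeff (mulCos β w) 0‖ ^ 2)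
    have h3 := hasSum_le (fun n => ?_) s1 (s2.add s3)
    · have h4 := norm_sq_mulCos_coeff_zero_le β w
      have h5 := sum_le_hasSum {(1 : ℤ), -1} (fun n _ => by positivity) (h.hasSum_commForm ha β)
      rw [Finset.sum_pair (by norm_num)] at h5
      have h6 : (1 / 12 : ℝ) ≤ a⁻¹ * (a + 4)⁻¹ := by
        rw [← mul_inv, ← one_div]
        exact one_div_le_one_div_of_le (by positivity) (by nlinarith)
      norm_num at h5
      have h7 := mul_le_mul_of_nonneg_right h6 (sq_nonneg ‖fourierCoeff w 1‖)
      have h8 := mul_le_mul_of_nonneg_right h6 (sq_nonneg ‖fourierCoeff w (-1)‖)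
      nlinarith
    · by_cases hn : n = 0
      · subst hn
        have h4 := inv_le_one_of_one_le₀ ha.le
        have h5 := sq_nonneg ‖fourierCoeff (mulCos β w) 0‖
        simp only [if_true, Int.cast_zero]
        rw [zero_pow two_ne_zero, add_zero]
        nlinarith
      · simp only [if_neg hn, add_zero]
        refine mul_le_mul_of_nonneg_right ?_ (by positivity)
        rw [← one_div]
        refine one_div_le_one_div_of_le (by norm_num) ?_
        have : (1 : ℤ) ≤ n ^ 2 := by nlinarith [sq_abs n, Int.one_le_abs hn]
        have h6 : (1 : ℝ) ≤ (n : ℝ) ^ 2 := by exact_mod_cast this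
        linarith

theorem IsWeakDeriv.norm_sq_mulCos_le {w w₁ : L2Circle} (h : IsWeakDeriv w w₁) {a : ℝ}
    (ha : 1 < a) (β : ℝ) :
    ‖mulCos β w‖ ^ 2 ≤ 6 * (starNorm a (mulCos β w) ^ 2 + commForm a β w w₁) := by
  have h1 := h.ip_mulCos_helmholtzInv_le ha β
  have h2 := starNorm_sq ha (mulCos β w)
  rw [starOp_apply, ip_sub_right, ip_self] at h2
  nlinarith [sq_nonneg (starNorm a (mulCos β w))]

/-- The energy identity for `(a - ∂_y²)⁻¹`. -/
theorem IsWeakDeriv.ip_helmholtzInv_eq {w w₁ : L2Circle} (h : IsWeakDeriv w w₁) {a : ℝ}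
    (ha : 0 < a) (v v₁ : L2Circle) (hv : IsWeakDeriv v v₁) :
    ip w v = a * ip (helmholtzInv a w) v + ip (helmholtzInv a w₁) v₁ := by
  have e := (h.helmholtz_inv₂ ha).ip_eq hv
  rw [ip_sub_left, ip_smul_left] at e
  linarith

theorem IsWeakDeriv.ip_helmholtzInv_self_le {w w₁ : L2Circle} (h : IsWeakDeriv w w₁) {a : ℝ}
    (ha : 1 < a) (β : ℝ) :
    ip w (helmholtzInv a w) ≤ 6 * ‖mulCos β w‖ ^ 2 + 26 * ‖helmholtzInv a w₁‖ ^ 2 := by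
  have ha0 : 0 < a := by linarith
  have dp := h.helmholtz_inv ha0
  set p := helmholtzInv a w with hp
  set p₁ := helmholtzInv a w₁ with hp₁
  have e1 := h.ip_helmholtzInv_eq ha0 p p₁ dp
  rw [← hp, ← hp₁, ip_self, ip_self] at e1
  -- Testing `a p - p'' = w` with `cos² p` bounds `a ‖cos p‖` by `‖cos w‖` and `‖p'‖`; the
  -- uncertainty inequality then recovers `‖p‖`.
  have e2 := h.ip_helmholtzInv_eq ha0 _ _ ((dp.cos_mul β).cos_mul β)
  rw [← hp, ← hp₁, ip_sub_right, map_sub, ip_sub_right, ← ip_mulCos β w, ← ip_mulCos β p,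
    ← ip_mulCos β p₁ (mulCos β p₁), ← ip_mulCos β p₁ (mulSin β p), ← ip_mulSin β p₁, ip_self,
    ip_self] at e2
  have e3 : ip (mulCos β p₁) (mulSin β p) = ip (mulSin β p₁) (mulCos β p) := by
    rw [ip_mulSin, ip_mulCos, mulCos, mulSin_comm]
  have b1 := (le_abs_self _).trans (abs_ip_le (mulCos β w) (mulCos β p))
  have b2 := (le_abs_self _).trans (abs_ip_le (mulSin β p₁) (mulCos β p))
  have b3 := norm_mulSin_le β p₁
  have b4 := dp.norm_sq_le β
  set Y := ‖mulCos β w‖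
  set x := ‖mulCos β p‖
  set t := ‖p₁‖
  have hx : 0 ≤ x := norm_nonneg _
  have ht : 0 ≤ t := norm_nonneg _
  have hY : 0 ≤ Y := norm_nonneg _
  have b5 : a * x * x ≤ (Y + 2 * t) * x := by
    nlinarith [mul_le_mul_of_nonneg_right b3 hx, sq_nonneg ‖mulCos β p₁‖]
  have b6 : a * x ≤ Y + 2 * t := by
    rcases hx.eq_or_lt with h0 | h0
    · rw [← h0, mul_zero]
      positivity
    · exact le_of_mul_le_mul_right b5 h0
  have b7 : a * ‖p‖ ^ 2 ≤ 2 * (a * x) ^ 2 + 2 * (a * x) * t := by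
    have : a * ‖p‖ ^ 2 ≤ a * (2 * x ^ 2 + 2 * (x * t)) := by gcongr
    nlinarith [mul_nonneg (mul_nonneg ha0.le (by linarith : 0 ≤ a - 1)) (sq_nonneg x)]
  have b8 : (a * x) ^ 2 ≤ (Y + 2 * t) ^ 2 := pow_le_pow_left₀ (by positivity) b6 2
  rw [e1]
  nlinarith [sq_nonneg (a * x - t), sq_nonneg (Y - 2 * t)]

/-- By duality: multiplication by the sine is bounded on `H¹` with norm `a ‖·‖² + ‖∂·‖²`, uniformly
for `a > 1`, hence on the dual space. -/
theorem IsWeakDeriv.ip_mulSin_helmholtzInv_le {w w₁ : L2Circle} (h : IsWeakDeriv w w₁) {a : ℝ}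
    (ha : 1 < a) (β : ℝ) :
    ip (mulSin β w) (helmholtzInv a (mulSin β w)) ≤ 3 * ip w (helmholtzInv a w) := by
  have ha0 : 0 < a := by linarith
  have dp := h.helmholtz_inv ha0
  have ds := h.sin_mul β
  have dq := ds.helmholtz_inv ha0
  set p := helmholtzInv a w with hp
  set p₁ := helmholtzInv a w₁ with hp₁
  set q := helmholtzInv a (mulSin β w) with hq
  set q₁ := helmholtzInv a (mulSin β w₁ + mulCos β w) with hq₁
  have e1 := h.ip_helmholtzInv_eq ha0 p p₁ dp
  have e2 := ds.ip_helmholtzInv_eq ha0 q q₁ dq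
  have e3 := h.ip_helmholtzInv_eq ha0 _ _ (dq.sin_mul β)
  rw [← hp, ← hp₁, ip_self, ip_self] at e1
  rw [← hq, ← hq₁, ip_self, ip_self] at e2
  rw [← hp, ← hp₁, ← ip_mulSin, ip_add_right] at e3
  have b1 := (le_abs_self _).trans (abs_ip_le p (mulSin β q))
  have b2 := (le_abs_self _).trans (abs_ip_le p₁ (mulSin β q₁))
  have b3 := (le_abs_self _).trans (abs_ip_le p₁ (mulCos β q))
  have c1 := mul_le_mul_of_nonneg_left (norm_mulSin_le β q) (norm_nonneg p)
  have c2 := mul_le_mul_of_nonneg_left (norm_mulSin_le β q₁) (norm_nonneg p₁)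
  have c3 := mul_le_mul_of_nonneg_left (norm_mulCos_le β q) (norm_nonneg p₁)
  have c4 : ip (mulSin β w) q ≤ a * (‖p‖ * ‖q‖) + ‖p₁‖ * ‖q₁‖ + ‖p₁‖ * ‖q‖ := by
    rw [e3]
    have := mul_le_mul_of_nonneg_left (b1.trans c1) ha0.le
    linarith
  have c5 : 0 ≤ a * (‖q‖ - 2 * ‖p‖) ^ 2 := by positivity
  have c6 : 0 ≤ (a - 1) * ‖q‖ ^ 2 := mul_nonneg (by linarith) (sq_nonneg _)
  rw [e1]
  nlinarith [sq_nonneg (‖q‖ - 2 * ‖p₁‖), sq_nonneg (‖q₁‖ - ‖p₁‖), mul_nonneg ha0.le (sq_nonneg ‖p‖)]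

/-- The symbol of `S` is smallest at mode `0`, with value `1 - 1/a`. This is the source of the
degeneracy as `a → 1`. -/
theorem ip_helmholtzInv_starOp_le {a : ℝ} (ha : 1 < a) (u : L2Circle) :
    (1 - a⁻¹) * ip (helmholtzInv a u) (starOp a u) ≤
      ip (starOp a u) (helmholtzInv a (starOp a u)) := by
  have ha0 : 0 < a := by linarith
  refine hasSum_le (fun n => ?_) ((hasSum_ip _ _).mul_left _)
    (ip_helmholtzInv_self_eq ha0 (starOp a u))
  have h2 := one_sub_inv_nonneg ha n
  have h3 := inv_add_sq_le ha0 n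
  have hpos : 0 < a + (n : ℝ) ^ 2 := by positivity
  rw [helmholtzInv_coeff ha0, starOp_coeff ha0, map_mul, Complex.conj_ofReal,
    mul_mul_mul_comm, mul_comm (conj _), Complex.mul_conj, ← Complex.ofReal_mul,
    ← Complex.ofReal_mul, Complex.ofReal_re, Complex.normSq_eq_norm_sq, norm_mul,
    Complex.norm_real, Real.norm_eq_abs, abs_of_nonneg h2, mul_pow]
  have : 0 ≤ (a + (n : ℝ) ^ 2)⁻¹ * (1 - (a + (n : ℝ) ^ 2)⁻¹) * ‖fourierCoeff u n‖ ^ 2 := by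
    positivity
  nlinarith [mul_nonneg this (sub_nonneg.2 h3)]

/-! ### The commutator estimate and the location of `l`. -/

namespace IsResolventSol

variable {a β ε l : ℝ} {u u₁ u₂ F : L2Circle}

/-- The multiplier `M = cos w' - sin w / 2` is the antisymmetrized `cos ∂` applied to `w`. The local
part of the pairing gives `‖cos w‖²`, and the resolvent corrections assemble into the star norm and
`commForm`. -/
theorem commutator (h : IsResolventSol a β ε l u u₁ u₂ F) :
    starNorm a (mulCos β (starOp a u)) ^ 2 + commForm a β (starOp a u) (starOp a u₁) ≤
      (starNorm a F + ε * starNorm a u₂) *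
        (2 * ‖mulCos β (starOp a u₁)‖ + ‖starOp a u‖) := by
  have ha := h.a_pos
  have dw := h.derivW
  have hI := h.I_smul_eq
  set w := starOp a u with hw
  set w₁ := starOp a u₁ with hw₁
  set M := mulCos β w₁ - ((1 / 2 : ℝ) : ℂ) • mulSin β w with hM
  have a1 : 2 * ip (mulCos β w₁) w = ip (mulSin β w) w := by
    have e := (dw.cos_mul β).ip_eq dw
    rw [ip_sub_left, ip_mulCos β w w₁, ip_comm w] at e
    linarith
  have a2 := dw.two_mul_ip_mulSin_mulCos β
  have e1 : -2 * ip (mulSin β w - (l : ℂ) • u) (starOp a M) =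
      starNorm a (mulCos β w) ^ 2 + commForm a β w w₁ := by
    -- By antisymmetry `⟨w, M⟩ = 0`, so the unknown `l` disappears.
    have e2 : ip u (starOp a M) = 0 := by
      rw [← ip_starOp ha, ← hw, hM, ip_sub_right, ip_smul_right, ip_comm w, ip_comm w]
      linarith
    rw [ip_sub_left, ip_smul_left, e2, starNorm_sq h.one_lt, starOp_apply a M,
      starOp_apply a (mulCos β w), ip_sub_right _ M, ← ip_helmholtzInv ha _ M, hM, commForm]
    simp only [ip_sub_right, ip_smul_right, ip_self]
    rw [ip_helmholtzInv ha (mulCos β w)]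
    linarith
  have e3 : ip (mulSin β w - (l : ℂ) • u) (starOp a M) =
      -(jp F (starOp a M) + ε * jp u₂ (starOp a M)) := by
    rw [hI, ip_neg_left, ip_I_smul_left, jp_add_left, jp_smul_left]
  have b1 := (le_abs_self _).trans (abs_jp_starOp_le h.one_lt F M)
  have b2 := (le_abs_self _).trans (abs_jp_starOp_le h.one_lt u₂ M)
  have b3 : starNorm a M ≤ ‖mulCos β w₁‖ + 1 / 2 * ‖w‖ := by
    refine (starNorm_le_norm h.one_lt M).trans ((norm_sub_le _ _).trans ?_)
    rw [norm_smul, Complex.norm_real, Real.norm_eq_abs, abs_of_pos (by norm_num : (0 : ℝ) < 1 / 2)]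
    have := norm_mulSin_le β w
    gcongr
  have hε := h.pos
  have c1 : 0 ≤ starNorm a F + ε * starNorm a u₂ :=
    add_nonneg (starNorm_nonneg _ _) (mul_nonneg hε.le (starNorm_nonneg _ _))
  have c2 := mul_le_mul_of_nonneg_left b3 c1
  have c3 := mul_le_mul_of_nonneg_left b2 hε.le
  rw [← e1, e3]
  linarith

theorem abs_le (h : IsResolventSol a β ε l u u₁ u₂ F) (hu : starNorm a u = 1) :
    |l| ≤ 1 + starNorm a F := by
  have e1 : ip (mulSin β (starOp a u) - (l : ℂ) • u) (starOp a u) = -jp F (starOp a u) := by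
    rw [h.I_smul_eq, ip_neg_left, ip_I_smul_left, jp_add_left, jp_smul_left,
      h.deriv₂.jp_eq h.derivW, jp_starOp_self h.a_pos]
    ring
  rw [ip_sub_left, ip_smul_left, ← starNorm_sq h.one_lt, hu] at e1
  have b1 := abs_jp_starOp_le h.one_lt F u
  rw [hu] at b1
  have b2 := abs_ip_le (mulSin β (starOp a u)) (starOp a u)
  have b3 := norm_mulSin_le β (starOp a u)
  have b4 := norm_starOp_le_starNorm h.one_lt u
  rw [hu] at b4
  have b5 : ‖mulSin β (starOp a u)‖ * ‖starOp a u‖ ≤ 1 * 1 := by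
    gcongr
    exact b3.trans b4
  have e2 : l = ip (mulSin β (starOp a u)) (starOp a u) + jp F (starOp a u) := by linarith
  rw [e2]
  refine (abs_add_le _ _).trans ?_
  linarith

/-- Pair `T u - l u` with `S (sin w)`. The main term `‖sin w‖_*²` equals `1` minus the first three
quantities on the right, while `l ⟨w, sin w⟩ ≤ |l|`. -/
theorem one_sub_abs_le (h : IsResolventSol a β ε l u u₁ u₂ F) (hu : starNorm a u = 1) :
    1 - |l| ≤ ‖mulCos β (starOp a u)‖ ^ 2 + ip (helmholtzInv a u) (starOp a u) +
      ip (mulSin β (starOp a u)) (helmholtzInv a (mulSin β (starOp a u))) + starNorm a F +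
      ε * (starNorm a u₁ * starNorm a (mulCos β (starOp a u))) := by
  have ha := h.a_pos
  have hI := h.I_smul_eq
  have dw := h.derivW
  have n1 := starNorm_sq_eq_norm_sq_add h.one_lt u
  have n2 := norm_starOp_le_starNorm h.one_lt u
  have n3 := starNorm_mulSin_starOp_le h.one_lt β u
  set w := starOp a u with hw
  set w₁ := starOp a u₁ with hw₁
  have e1 : ip (mulSin β w - (l : ℂ) • u) (starOp a (mulSin β w)) =
      -jp F (starOp a (mulSin β w)) + ε * jp u₁ (starOp a (mulCos β w)) := by
    have e2 := h.deriv₂.jp_eq ((dw.sin_mul β).starOp ha)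
    have e3 : jp u₁ (starOp a (mulSin β w₁)) = 0 := by
      rw [← jp_starOp ha, ← hw₁, ← jp_mulSin, jp_mulSin_self]
    rw [map_add, jp_add_right, e3] at e2
    rw [hI, ip_neg_left, ip_I_smul_left, jp_add_left, jp_smul_left, e2]
    ring
  rw [ip_sub_left, ip_smul_left, ← ip_starOp ha u, ← hw] at e1
  rw [starOp_apply a (mulSin β w), ip_sub_right, ip_self, ← starOp_apply] at e1
  have n4 := norm_sq_mulSin_add_norm_sq_mulCos β w
  have b1 := neg_abs_le (jp F (starOp a (mulSin β w)))
  have b1' := le_abs_self (jp F (starOp a (mulSin β w)))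
  have b2 := abs_jp_starOp_le h.one_lt F (mulSin β w)
  have b3 := (le_abs_self _).trans (abs_jp_starOp_le h.one_lt u₁ (mulCos β w))
  have b4 := abs_ip_le w (mulSin β w)
  rw [hu] at n1 n2 n3
  have b5 : |ip w (mulSin β w)| ≤ 1 := by
    refine b4.trans ?_
    have : ‖w‖ * ‖mulSin β w‖ ≤ 1 * 1 := by
      gcongr
      exact (norm_mulSin_le β w).trans n2
    linarith
  have b6 : l * ip w (mulSin β w) ≤ |l| := by
    refine (le_abs_self _).trans ?_
    rw [abs_mul]
    exact mul_le_of_le_one_right (abs_nonneg l) b5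
  have b7 : starNorm a F * starNorm a (mulSin β w) ≤ starNorm a F :=
    mul_le_of_le_one_right (starNorm_nonneg a F) n3
  have b8 := mul_le_mul_of_nonneg_left b3 h.pos.le
  linarith

end IsResolventSol

/-! ### The resolvent bound -/

/-- Dictionary: `f = ‖F‖_*`; `d`, `A` are the star norms of `u'`, `u''`; `X = ‖cos w'‖`, `V = ‖w‖`,
`L = |l|`, `W = |1 - l²|`, `ρ⁴ = ε`, `θ⁴ = 1 - 1/a`. If `f < k²ρ²` with `k = θ³ / 10⁶`, every term
on the right of `h7` is small. -/
theorem forcing_lower_bound {ρ θ f d A X V z L W : ℝ} (hρ : 0 < ρ) (hρ1 : ρ ≤ 1) (hθ : 0 < θ)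
    (hθ1 : θ ≤ 1) (hf : 0 ≤ f) (hd : 0 ≤ d) (hA : 0 ≤ A) (hX : 0 ≤ X) (hV : 0 ≤ V) (hz : 0 ≤ z)
    (h1 : ρ ^ 4 * d ^ 2 ≤ f) (h2 : ρ ^ 4 * A ^ 2 ≤ f * A + z * d)
    (h3 : ρ ^ 4 * X ^ 2 ≤ W * f + (1 + L) * (f * (ρ ^ 4 * A)) + ρ ^ 4 * V ^ 2)
    (hW : W ≤ (1 + L) * (358 * (z ^ 2 / θ ^ 4) + f + ρ ^ 4 * (d * z))) (hLf : L ≤ 1 + f)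
    (h4 : z ^ 2 ≤ (f + ρ ^ 4 * A) * (2 * X + V)) (h6 : V ^ 2 ≤ 12 * z ^ 2 + 5 * (z * d))
    (h7 : 1 ≤ V ^ 2 + 88 * (z ^ 2 / θ ^ 4)) :
    (1 / 10 ^ 6 * θ ^ 3) ^ 2 * ρ ^ 2 ≤ f := by
  by_contra! hlt
  obtain ⟨γ, hγ⟩ : ∃ γ : ℝ, γ = 1 / 10 ^ 6 := ⟨_, rfl⟩
  obtain ⟨k, hk⟩ : ∃ k : ℝ, k = γ * θ ^ 3 := ⟨_, rfl⟩
  rw [← hγ, ← hk] at hlt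
  have hγ0 : 0 < γ := by rw [hγ]; norm_num
  have hk0 : 0 < k := by rw [hk]; positivity
  have hkγ : k ≤ γ := by
    rw [hk]
    exact mul_le_of_le_one_right hγ0.le (pow_le_one₀ hθ.le hθ1)
  have hk1 : k ≤ 1 := hkγ.trans (by rw [hγ]; norm_num)
  have hk2 : k ^ 2 ≤ 1 := pow_le_one₀ hk0.le hk1
  have hρ2 : ρ ^ 2 ≤ 1 := pow_le_one₀ hρ.le hρ1
  have hf1 : f ≤ 1 := by
    have : k ^ 2 * ρ ^ 2 ≤ 1 * 1 := by gcongr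
    linarith
  have hρd : ρ * d ≤ k := by
    refine le_of_sq_le_sq ?_ hk0.le
    refine le_of_mul_le_mul_left ?_ (by positivity : 0 < ρ ^ 2)
    have : ρ ^ 2 * (ρ * d) ^ 2 = ρ ^ 4 * d ^ 2 := by ring
    linarith
  -- `m` dominates `z d`, because the energy bound gives `d ≤ k / ρ`.
  obtain ⟨m, hm⟩ : ∃ m : ℝ, m = z * k / ρ := ⟨_, rfl⟩
  have hm0 : 0 ≤ m := by rw [hm]; positivity
  have hmρ : m * ρ = z * k := by rw [hm]; field_simp
  have hzd : z * d ≤ m := by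
    refine le_of_mul_le_mul_right ?_ hρ
    rw [hmρ]
    have := mul_le_mul_of_nonneg_left hρd hz
    linarith
  obtain ⟨α, hα⟩ : ∃ α : ℝ, α = ρ ^ 2 * A := ⟨_, rfl⟩
  have hα0 : 0 ≤ α := by rw [hα]; positivity
  -- `B` is the size of the roots of `α² = k² α + m`, the quadratic inequality that `h2` imposes on
  -- `α = ρ² A`.
  obtain ⟨B, hB0, hB⟩ : ∃ B : ℝ, 0 ≤ B ∧ B ^ 2 = k ^ 4 + m :=
    ⟨Real.sqrt (k ^ 4 + m), Real.sqrt_nonneg _, Real.sq_sqrt (by positivity)⟩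
  have hkB : k ^ 2 ≤ B := le_of_sq_le_sq (by rw [hB]; linarith) hB0
  have hmB : m ≤ B ^ 2 := by rw [hB]; linarith [pow_nonneg hk0.le 4]
  have hαB : α ≤ 2 * B := by
    refine le_of_sq_le_sq ?_ (by positivity)
    have e1 : α ^ 2 ≤ k ^ 2 * α + m := by
      have : f * A ≤ k ^ 2 * ρ ^ 2 * A := mul_le_mul_of_nonneg_right hlt.le hA
      have e2 : α ^ 2 = ρ ^ 4 * A ^ 2 := by rw [hα]; ring
      have e3 : k ^ 2 * α = k ^ 2 * ρ ^ 2 * A := by rw [hα]; ring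
      linarith
    have e4 := sq_nonneg (α - k ^ 2)
    have e5 := pow_nonneg hk0.le 4
    linarith
  have hV2 : V ^ 2 ≤ 12 * z ^ 2 + 5 * B ^ 2 := by linarith
  obtain ⟨q, hq⟩ : ∃ q : ℝ, q = m / θ ^ 2 := ⟨_, rfl⟩
  have hq0 : 0 ≤ q := by rw [hq]; positivity
  have hzq : k ^ 2 * (z ^ 2 / θ ^ 4) = q ^ 2 * ρ ^ 2 := by
    have : q ^ 2 * ρ ^ 2 = (m * ρ) ^ 2 / θ ^ 4 := by rw [hq]; ring
    rw [this, hmρ]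
    ring
  have hX2 : X ^ 2 ≤ 1074 * q ^ 2 + 17 * B ^ 2 + 12 * z ^ 2 := by
    have e1 : W ≤ 3 * (358 * (z ^ 2 / θ ^ 4) + f + ρ ^ 4 * (d * z)) :=
      hW.trans (mul_le_mul_of_nonneg_right (by linarith) (by positivity))
    have e2 : 358 * (z ^ 2 / θ ^ 4) + f + ρ ^ 4 * (d * z) ≤
        358 * (z ^ 2 / θ ^ 4) + k ^ 2 * ρ ^ 2 + ρ ^ 4 * m := by
      rw [mul_comm d z]
      gcongr
    have e3 : W * f ≤ 3 * (358 * (z ^ 2 / θ ^ 4) + k ^ 2 * ρ ^ 2 + ρ ^ 4 * m) *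
        (k ^ 2 * ρ ^ 2) := by
      refine mul_le_mul (e1.trans (by linarith)) hlt.le hf (by positivity)
    have e4 : (1 + L) * (f * (ρ ^ 4 * A)) ≤ 3 * (k ^ 2 * ρ ^ 2 * (ρ ^ 4 * A)) := by
      gcongr
      linarith
    have e5 : ρ ^ 4 * X ^ 2 ≤ ρ ^ 4 * (1074 * q ^ 2 + 3 * k ^ 4 + 3 * k ^ 2 * (ρ ^ 2 * m) +
        3 * k ^ 2 * α + V ^ 2) := by
      have : 3 * (358 * (z ^ 2 / θ ^ 4) + k ^ 2 * ρ ^ 2 + ρ ^ 4 * m) * (k ^ 2 * ρ ^ 2) =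
          ρ ^ 4 * (1074 * q ^ 2 + 3 * k ^ 4 + 3 * k ^ 2 * (ρ ^ 2 * m)) := by
        linear_combination 1074 * ρ ^ 2 * hzq
      have : 3 * (k ^ 2 * ρ ^ 2 * (ρ ^ 4 * A)) = ρ ^ 4 * (3 * k ^ 2 * α) := by rw [hα]; ring
      linarith
    have e6 := le_of_mul_le_mul_left e5 (by positivity)
    have e7 : k ^ 2 * (ρ ^ 2 * m) ≤ 1 * (1 * m) := by gcongr
    have e8 : k ^ 2 * α ≤ B * (2 * B) := by gcongr
    have e9 : k ^ 4 ≤ B ^ 2 := by rw [hB]; linarith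
    linarith
  have hXle : X ≤ 33 * q + 5 * B + 4 * z := by
    refine le_of_sq_le_sq ?_ (by positivity)
    linarith [mul_nonneg hq0 hB0, mul_nonneg hq0 hz, mul_nonneg hB0 hz, sq_nonneg q, sq_nonneg B,
      sq_nonneg z]
  have hVle : V ≤ 4 * z + 3 * B := by
    refine le_of_sq_le_sq ?_ (by positivity)
    linarith [mul_nonneg hB0 hz, sq_nonneg B, sq_nonneg z]
  have hz2 : z ^ 2 ≤ 1400 * ρ ^ 2 * (B * (B + q)) := by
    have e1 : f + ρ ^ 4 * A ≤ ρ ^ 2 * (3 * B) := by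
      have : ρ ^ 4 * A = ρ ^ 2 * α := by rw [hα]; ring
      rw [this]
      linarith [mul_nonneg (sq_nonneg ρ) (sub_nonneg.2 hkB),
        mul_nonneg (sq_nonneg ρ) (sub_nonneg.2 hαB)]
    have e2 : (f + ρ ^ 4 * A) * (2 * X + V) ≤
        ρ ^ 2 * (3 * B) * (66 * q + 13 * B + 12 * z) :=
      mul_le_mul e1 (by linarith) (by positivity) (by positivity)
    have e3 : ρ ^ 4 * B ^ 2 ≤ ρ ^ 2 * B ^ 2 :=
      mul_le_mul_of_nonneg_right
        (pow_le_pow_of_le_one hρ.le hρ1 (by norm_num)) (sq_nonneg B)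
    have e4 : 0 ≤ ρ ^ 2 * (B * q) := by positivity
    have e5 : 0 ≤ ρ ^ 2 * (B * B) := by positivity
    linarith [sq_nonneg (z - 36 * (ρ ^ 2 * B))]
  have hkq : k ^ 2 * q ≤ γ ^ 2 * m := by
    have : k ^ 2 * q = γ ^ 2 * m * θ ^ 4 := by rw [hk, hq]; field_simp
    rw [this]
    exact mul_le_of_le_one_right (by positivity) (pow_le_one₀ hθ.le hθ1)
  have hkq' : k ^ 2 * q ≤ γ * k * m := by
    have : k ^ 2 * q = γ * k * m * θ := by rw [hk, hq]; field_simp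
    rw [this]
    exact mul_le_of_le_one_right (by positivity) hθ1
  -- The loop closes here: `m ρ = z k` turns the bound on `z²` into one on `m²`, and `B² = k⁴ + m`
  -- then forces `m ≲ k²`. The powers of `θ` in `k` absorb the `θ⁻²` in `q`.
  have hm2 : m ^ 2 ≤ 2801 * k ^ 2 * B ^ 2 := by
    have e1 : m ^ 2 ≤ 1400 * (k ^ 2 * B ^ 2 + B * (k ^ 2 * q)) := by
      refine le_of_mul_le_mul_right ?_ (by positivity : 0 < ρ ^ 2)
      have : m ^ 2 * ρ ^ 2 = k ^ 2 * z ^ 2 := by rw [← mul_pow, hmρ]; ring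
      rw [this]
      linarith [mul_le_mul_of_nonneg_left hz2 (sq_nonneg k)]
    have e2 : B * (k ^ 2 * q) ≤ B * (γ * k * m) := by gcongr
    have e3 : (1400 * γ) ^ 2 ≤ 1 := by rw [hγ]; norm_num
    have e4 : (1400 * γ) ^ 2 * (k * B) ^ 2 ≤ 1 * (k * B) ^ 2 := by gcongr
    linarith [sq_nonneg (m - 1400 * γ * (k * B))]
  have hmk : m ≤ 2810 * k ^ 2 := by
    refine le_of_sq_le_sq ?_ (by positivity)
    rw [hB] at hm2
    have e1 : k ^ 2 * k ^ 4 ≤ 1 * k ^ 4 := by gcongr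
    linarith [sq_nonneg (m - 2801 * k ^ 2), pow_nonneg hk0.le 4]
  have hBk : B ≤ 54 * k := by
    refine le_of_sq_le_sq ?_ (by positivity)
    rw [hB]
    linarith [mul_le_mul_of_nonneg_left hk2 (sq_nonneg k)]
  have hkθ : k ≤ γ * θ ^ 2 := by
    rw [hk]
    have : θ ^ 3 ≤ θ ^ 2 := pow_le_pow_of_le_one hθ.le hθ1 (by norm_num)
    gcongr
  have hqk : q ≤ 2810 * (γ * k) := by
    rw [hq, div_le_iff₀ (by positivity)]
    linarith [mul_le_mul_of_nonneg_left hkθ hk0.le]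
  have hγ1 : γ ≤ 1 := by rw [hγ]; norm_num
  have hzk : z ^ 2 ≤ 1400 * (54 * k * (54 * k + 2810 * k)) := by
    have e1 : B * (B + q) ≤ 54 * k * (54 * k + 2810 * k) := by
      have : q ≤ 2810 * k := hqk.trans (by gcongr; exact mul_le_of_le_one_left hk0.le hγ1)
      gcongr
    have e2 : 1400 * ρ ^ 2 * (B * (B + q)) ≤ 1400 * 1 * (54 * k * (54 * k + 2810 * k)) := by
      gcongr
    linarith
  have hzθ : z ^ 2 / θ ^ 4 ≤ 220000000 * γ ^ 2 := by
    rw [div_le_iff₀ (by positivity)]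
    have e1 : k ^ 2 ≤ (γ * θ ^ 2) ^ 2 := pow_le_pow_left₀ hk0.le hkθ 2
    have e2 := sq_nonneg (γ * θ ^ 2)
    linarith
  have hmγ : m ≤ 2810 * γ ^ 2 := by
    have : k ^ 2 ≤ γ ^ 2 := pow_le_pow_left₀ hk0.le hkγ 2
    linarith
  have hzz : z ^ 2 ≤ z ^ 2 / θ ^ 4 := by
    rw [le_div_iff₀ (by positivity)]
    exact mul_le_of_le_one_right (sq_nonneg z) (pow_le_one₀ hθ.le hθ1)
  have : γ ^ 2 = 1 / 10 ^ 12 := by rw [hγ]; norm_num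
  rw [this] at hzθ hmγ
  norm_num at hzθ hmγ
  linarith

theorem IsResolventSol.le_starNorm {a β ρ θ l : ℝ} {u u₁ u₂ F : L2Circle} (hρ : 0 < ρ)
    (hρ1 : ρ ≤ 1) (hθ : 0 < θ) (hθa : θ ^ 4 = 1 - a⁻¹)
    (h : IsResolventSol a β (ρ ^ 4) l u u₁ u₂ F) (hu : starNorm a u = 1) :
    (1 / 10 ^ 6 * θ ^ 3) ^ 2 * ρ ^ 2 ≤ starNorm a F := by
  have ha := h.one_lt
  have dw := h.derivW
  have hθ1 : θ ≤ 1 := by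
    by_contra! hlt
    have h1 := one_lt_pow₀ hlt (by norm_num : 4 ≠ 0)
    have := inv_pos.2 h.a_pos
    linarith
  have hη1 : θ ^ 4 ≤ 1 := pow_le_one₀ hθ.le hθ1
  have hη : 0 < θ ^ 4 := by positivity
  have p1 := h.energy
  have p2 := h.second_order
  have p3 := h.cos_deriv
  have p4 := h.commutator
  have p5 := h.one_sub_abs_le hu
  have p5' := h.abs_le hu
  have p6 := dw.norm_sq_le β
  have p7 := dw.norm_sq_mulCos_le ha β
  have p8 := dw.ip_helmholtzInv_self_le ha β
  have p9 := dw.norm_sq_helmholtzInv_le ha β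
  have p10 := ip_helmholtzInv_starOp_le ha u
  have p11 := dw.ip_mulSin_helmholtzInv_le ha β
  have p12 := starNorm_sq_eq_norm_sq_add ha u
  have p13 := norm_starOp_le_starNorm ha u₁
  have p14 := dw.commForm_nonneg ha β
  rw [hu] at p12 p1 p3
  rw [← hθa] at p10
  set w := starOp a u
  set w₁ := starOp a u₁
  set T := commForm a β w w₁
  set y := starNorm a (mulCos β w)
  set Q := ip (helmholtzInv a u) w
  have hy : 0 ≤ y := starNorm_nonneg _ _
  have hd : 0 ≤ starNorm a u₁ := starNorm_nonneg _ _
  obtain ⟨z, hz0, hz⟩ : ∃ z : ℝ, 0 ≤ z ∧ z ^ 2 = y ^ 2 + T :=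
    ⟨Real.sqrt (y ^ 2 + T), Real.sqrt_nonneg _, Real.sq_sqrt (by positivity)⟩
  have hyz : y ≤ z := le_of_sq_le_sq (by linarith) hz0
  have hYz : ‖mulCos β w‖ ≤ 5 / 2 * z :=
    le_of_sq_le_sq (by nlinarith [sq_nonneg z]) (by positivity)
  -- `88 = 6 · 6 + 26 · 2`, from the bounds on `‖cos w‖²` and `‖H w'‖²`.
  have hE : ip w (helmholtzInv a w) ≤ 88 * z ^ 2 := by nlinarith [sq_nonneg y]
  have hQ : Q ≤ 88 * (z ^ 2 / θ ^ 4) := by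
    rw [← mul_div_assoc, le_div_iff₀ hη]
    linarith
  have hzz : z ^ 2 ≤ z ^ 2 / θ ^ 4 := by
    rw [le_div_iff₀ hη]
    exact mul_le_of_le_one_right (sq_nonneg z) hη1
  refine forcing_lower_bound (d := starNorm a u₁) (A := starNorm a u₂) (X := ‖mulCos β w₁‖)
    (V := ‖w‖) (z := z) (L := |l|) (W := |1 - l ^ 2|) hρ hρ1 hθ hθ1 (starNorm_nonneg _ _) hd
    (starNorm_nonneg _ _) (norm_nonneg _) (norm_nonneg _) hz0 (by linarith) ?_
    (by linarith) ?_ p5' ?_ ?_ ?_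
  · have := mul_le_mul_of_nonneg_right hyz hd
    linarith
  -- The constant is `358 = 6 + 88 + 3 · 88`, one summand for each of the first three terms of
  -- `one_sub_abs_le`.
  · have e1 : |1 - l ^ 2| = (1 + |l|) * |1 - (|l|)| := by
      rw [← sq_abs l, show 1 - |l| ^ 2 = (1 + |l|) * (1 - |l|) by ring, abs_mul,
        abs_of_nonneg (by positivity : 0 ≤ 1 + |l|)]
    rw [e1]
    refine mul_le_mul_of_nonneg_left ?_ (by positivity)
    have e2 : 0 ≤ ρ ^ 4 * (starNorm a u₁ * z) := by positivity
    have e3 : ρ ^ 4 * (starNorm a u₁ * y) ≤ ρ ^ 4 * (starNorm a u₁ * z) := by gcongr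
    rw [abs_le']
    constructor
    · linarith
    · linarith [sq_nonneg z]
  · rw [hz]
    exact p4
  · have e1 : ‖mulCos β w‖ * ‖w₁‖ ≤ 5 / 2 * z * starNorm a u₁ := by gcongr
    linarith
  · linarith

/-! ### Nonemptiness of the infimum and rescaling to the original operator. -/

/-- A normalized constant works. Without such a vector the real infimum would be that of the empty
set, which is `0` by convention. -/
theorem exists_mem_H2_starNorm_eq_one {a : ℝ} (ha : 1 < a) : ∃ u : H2, starNorm a u = 1 := by
  have hc : ∀ n : ℤ, fourierCoeff (fourierLp 2 0 : L2Circle) n = if n = 0 then 1 else 0 := by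
    intro n
    rw [← fourierBasis_repr, ← coe_fourierBasis, HilbertBasis.repr_self, lp.single_apply]
    by_cases hn : n = 0
    · subst hn
      simp
    · simp [hn]
  have hd : IsWeakDeriv (fourierLp 2 0 : L2Circle) 0 := by
    rw [isWeakDeriv_iff]
    intro n
    rw [coeff_zero, hc]
    by_cases hn : n = 0
    · simp [hn]
    · simp [hn]
  have hpos : 0 < starNorm a (fourierLp 2 0 : L2Circle) := by
    refine lt_of_lt_of_le ?_ (norm_starOp_le_starNorm ha _)
    rw [norm_pos_iff]
    intro h0
    have h1 := starOp_coeff (by linarith : 0 < a) (fourierLp 2 0 : L2Circle) 0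
    rw [h0, coeff_zero, hc, if_pos rfl, mul_one] at h1
    have h2 : (1 - (a + ((0 : ℤ) : ℝ) ^ 2)⁻¹ : ℝ) = 0 := by exact_mod_cast h1.symm
    have h3 := inv_lt_one_of_one_lt₀ ha
    norm_num at h2
    linarith
  refine ⟨⟨((starNorm a (fourierLp 2 0 : L2Circle))⁻¹ : ℝ) • (fourierLp 2 0 : L2Circle), ?_⟩, ?_⟩
  · exact H2.smul_mem (((starNorm a (fourierLp 2 0 : L2Circle))⁻¹ : ℝ) : ℂ)
      ⟨0, 0, hd, isWeakDeriv_zero⟩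
  · have := starNorm_smul (a := a) (starNorm a (fourierLp 2 0 : L2Circle))⁻¹ (fourierLp 2 0)
    rw [abs_of_pos (inv_pos.2 hpos), inv_mul_cancel₀ hpos.ne'] at this
    exact this

theorem opL_apply (ν δ : ℝ) (k₁ k₂ : ℤ) (u : H2) :
    opL ν δ k₁ k₂ u = (-((ν * (δ⁻¹) ^ 2 : ℝ) : ℂ)) • d2 u +
      (Complex.I * ((kNorm k₁ k₂ * δ ^ 2 : ℝ) : ℂ)) •
        mulSin (kAngle k₁ k₂) (starOp (alphaSq δ k₁ k₂) u) := rfl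

theorem one_le_kNorm {k₁ k₂ : ℤ} (h : 0 < kNorm k₁ k₂) : 1 ≤ kNorm k₁ k₂ := by
  have h0 : 0 < (k₁ : ℝ) ^ 2 + (k₂ : ℝ) ^ 2 := Real.sqrt_pos.1 h
  have h1 : (0 : ℤ) < k₁ ^ 2 + k₂ ^ 2 := by exact_mod_cast h0
  have h2 : (1 : ℝ) ≤ (k₁ : ℝ) ^ 2 + (k₂ : ℝ) ^ 2 := by exact_mod_cast h1
  exact Real.one_le_sqrt.2 h2

theorem le_starNorm_opL_sub {ν δ : ℝ} {k₁ k₂ : ℤ} (hδ : 1 ≤ δ) (hν : 0 < ν) (hν1 : ν < 1)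
    (ha : 1 < alphaSq δ k₁ k₂) (u : H2) (hu : starNorm (alphaSq δ k₁ k₂) u = 1) (μ : ℝ) :
    1 / 10 ^ 12 * kNorm k₁ k₂ ^ (1 / 2 : ℝ) * ν ^ (1 / 2 : ℝ) *
        (1 - (alphaSq δ k₁ k₂)⁻¹) ^ (3 / 2 : ℝ) ≤
      starNorm (alphaSq δ k₁ k₂)
        (opL ν δ k₁ k₂ u - (Complex.I * (μ : ℂ)) • (u : L2Circle)) := by
  have hκ0 : 0 < kNorm k₁ k₂ := by
    refine lt_of_le_of_ne (Real.sqrt_nonneg _) fun h => ?_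
    rw [alphaSq, ← h] at ha
    norm_num at ha
  have hκ := one_le_kNorm hκ0
  rw [opL_apply]
  set κ := kNorm k₁ k₂
  set a := alphaSq δ k₁ k₂
  set β := kAngle k₁ k₂
  have hδ0 : 0 < δ := by linarith
  obtain ⟨b, hb⟩ : ∃ b : ℝ, b = κ * δ ^ 2 := ⟨_, rfl⟩
  have hb1 : 1 ≤ b := by
    rw [hb]
    exact one_le_mul_of_one_le_of_one_le hκ (one_le_pow₀ hδ)
  have hb0 : 0 < b := by linarith
  obtain ⟨ε, hε⟩ : ∃ ε : ℝ, ε = ν * (δ⁻¹) ^ 2 / b := ⟨_, rfl⟩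
  have hε0 : 0 < ε := by rw [hε]; positivity
  have hε1 : ε ≤ 1 := by
    rw [hε, div_le_one hb0]
    have h1 : δ⁻¹ ^ 2 ≤ 1 := pow_le_one₀ (by positivity) (inv_le_one_of_one_le₀ hδ)
    nlinarith
  have hη0 : 0 < 1 - a⁻¹ := sub_pos.2 (inv_lt_one_of_one_lt₀ ha)
  have root : ∀ x : ℝ, 0 < x → (x ^ (1 / 4 : ℝ)) ^ 4 = x := fun x hx => by
    rw [← Real.rpow_natCast, ← Real.rpow_mul hx.le]
    norm_num
  set F := Complex.I • (mulSin β (starOp a u) - ((μ / b : ℝ) : ℂ) • (u : L2Circle)) -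
    (ε : ℂ) • d2 u with hF
  have e1 : (-((ν * (δ⁻¹) ^ 2 : ℝ) : ℂ)) • d2 u + (Complex.I * ((κ * δ ^ 2 : ℝ) : ℂ)) •
      mulSin β (starOp a u) - (Complex.I * (μ : ℂ)) • (u : L2Circle) = (b : ℂ) • F := by
    have e2 : ν * (δ⁻¹) ^ 2 = b * ε := by rw [hε]; field_simp
    have e3 : (μ : ℂ) = (b : ℂ) * ((μ / b : ℝ) : ℂ) := by
      rw [← Complex.ofReal_mul, mul_div_cancel₀ _ hb0.ne']
    rw [e2, ← hb, hF, e3, Complex.ofReal_mul]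
    module
  obtain ⟨u₁, h1, h2⟩ := d2_spec u
  have hsol : IsResolventSol a β ((ε ^ (1 / 4 : ℝ)) ^ 4) (μ / b) u u₁ (d2 u) F := by
    rw [root ε hε0]
    exact ⟨ha, hε0, h1, h2, rfl⟩
  have key := hsol.le_starNorm (by positivity) (Real.rpow_le_one hε0.le hε1 (by norm_num))
    (by positivity : 0 < (1 - a⁻¹) ^ (1 / 4 : ℝ)) (root _ hη0) hu
  rw [e1, starNorm_smul, abs_of_pos hb0]
  refine le_trans (le_of_eq ?_) (mul_le_mul_of_nonneg_left key hb0.le)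
  have r1 : (ε ^ (1 / 4 : ℝ)) ^ 2 = ε ^ (1 / 2 : ℝ) := by
    rw [← Real.rpow_natCast, ← Real.rpow_mul hε0.le]
    norm_num
  have r2 : (((1 - a⁻¹) ^ (1 / 4 : ℝ)) ^ 3) ^ 2 = (1 - a⁻¹) ^ (3 / 2 : ℝ) := by
    rw [← pow_mul, ← Real.rpow_natCast, ← Real.rpow_mul hη0.le]
    norm_num
  -- All powers of `δ` cancel, since `b² ε = b ν δ⁻² = |k| ν`.
  have r3 : b * ε ^ (1 / 2 : ℝ) = κ ^ (1 / 2 : ℝ) * ν ^ (1 / 2 : ℝ) := by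
    have hbb : b = (b ^ 2) ^ (1 / 2 : ℝ) := by
      rw [← Real.sqrt_eq_rpow, Real.sqrt_sq hb0.le]
    nth_rw 1 [hbb]
    rw [← Real.mul_rpow (by positivity) hε0.le, ← Real.mul_rpow hκ0.le hν.le]
    congr 1
    rw [hε, hb]
    field_simp
  rw [mul_pow, r1, r2]
  linear_combination (-(1 / 10 ^ 12) * (1 - a⁻¹) ^ (3 / 2 : ℝ)) * r3

end

end HelicalFlow

theorem lemma3p2 :
    ∃ c₂ : ℝ, 0 < c₂ ∧ ∃ ν₀ : ℝ, 0 < ν₀ ∧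
      ∀ δ : ℝ, 1 ≤ δ → ∀ ν : ℝ, 0 < ν → ν < ν₀ →
        ∀ k₁ k₂ : ℤ, 1 < HelicalFlow.alphaSq δ k₁ k₂ →
          c₂ * HelicalFlow.kNorm k₁ k₂ ^ (1 / 2 : ℝ) * ν ^ (1 / 2 : ℝ) *
              (1 - (HelicalFlow.alphaSq δ k₁ k₂)⁻¹) ^ (3 / 2 : ℝ) ≤
            HelicalFlow.pseudospectralBound
              (HelicalFlow.starNorm (HelicalFlow.alphaSq δ k₁ k₂))
              (HelicalFlow.opL ν δ k₁ k₂) := by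
  refine ⟨1 / 10 ^ 12, by norm_num, 1, one_pos, fun δ hδ ν hν hν1 k₁ k₂ ha => ?_⟩
  refine le_csInf ?_ ?_
  · obtain ⟨u, hu⟩ := HelicalFlow.exists_mem_H2_starNorm_eq_one ha
    exact ⟨_, u, 0, hu, rfl⟩
  · rintro r ⟨u, μ, hu, rfl⟩
    exact HelicalFlow.le_starNorm_opL_sub hδ hν hν1 ha u hu μ
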